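/- **Notation.** Let $n\ge 0$, let $\mathbb T^n=\mathbb R^n/\mathbb Z^n$ carry normalised Haar measure, and let $|k|$ be the Euclidean length of $k\in\mathbb Z^n$. Put $\Delta_{k_j}f(k)=f(k+e_j)-f(k)$, $\Delta_k^\alpha=\Delta_{k_1}^{\alpha_1}\cdots\Delta_{k_n}^{\alpha_n}$, and $D_x^{(\beta)}=\prod_{j=1}^n\prod_{\ell=0}^{\beta_j-1}\bigl(\tfrac1{2\pi i}\partial_{x_j}-\ell\bigr)$ (so $D_x^{(0)}=I$). A function $\Lambda:\mathbb Z^n\to\mathbb R$ is a *weight function* with top exponent $\mu$ if there are constants $0<\mu_0\le\mu_1\le\mu$ and $C_0,C_1>0$ with $C_0(1+|k|)^{\mu_0}\le\Lambda(k)\le C_1(1+|k|)^{\mu_1}$ for all $k$, and for all $\alpha\in\mathbb N_0^n$, $\gamma\in\{0,1\}^n$ there is $C_{\alpha,\gamma}>0$ with $|k^\gamma\Delta_k^{\alpha+\gamma}\Lambda(k)|\le C_{\alpha,\gamma}\Lambda(k)^{1-|\alpha|/\mu}$ for all $k\in\mathbb Z^n$. For $m\in\mathbb R$ and $0<\rho\le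 1/\mu$, $S^m_{\rho,\Lambda}$ is the set of $\sigma:\mathbb Z^n\times\mathbb T^n\to\mathbb C$, smooth in $x$, such that for all $\alpha,\beta\in\mathbb N_0^n$ there is $C_{\alpha,\beta}>0$ with $|D_x^{(\beta)}\Delta_k^\alpha\sigma(k,x)|\le C_{\alpha,\beta}\Lambda(k)^{m-\rho|\alpha|}$ for all $(k,x)$; and $M^m_{\rho,\Lambda}$ is the set of $\sigma$, smooth in $x$, with $k^\gamma\Delta_k^\gamma\sigma\in S^m_{\rho,\Lambda}$ for every $\gamma\in\{0,1\}^n$. A symbol $\sigma\in M^m_{\rho,\Lambda}$ is *$M$-elliptic* if there are $C,R>0$ with $|\sigma(k,x)|\ge C\Lambda(k)^m$ for all $x\in\mathbb T^n$ and all $|k|\ge R$. Let $\mathcal S(\mathbb Z^n)$ be the space of rapidly decreasing functions on $\mathbb Z^n$ and $\mathcal S'(\mathbb Z^n)$ the space of functions of polynomial growth. For $f\in\mathcal S(\mathbb Z^n)$ let $\widehat f(x)=\sum_k e^{-2\pi i k\cdot x}f(k)$ and $T_\sigma f(k)=\int_{\mathbb T^n}e^{2\pi i k\cdot x}\sigma(k,x)\widehat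 f(x)\,dx$. The *minimal operator* $T_{\sigma,0}$ is the closure in $\ell^2(\mathbb Z^n)$ of $T_\sigma$ with domain $\mathcal S(\mathbb Z^n)$: its domain $\mathrm{Dom}(T_{\sigma,0})$ consists of all $g\in\ell^2(\mathbb Z^n)$ for which there are $\varphi_j\in\mathcal S(\mathbb Z^n)$ and $f\in\ell^2(\mathbb Z^n)$ with $\varphi_j\to g$ and $T_\sigma\varphi_j\to f$ in $\ell^2(\mathbb Z^n)$. For $s\in\mathbb R$, let $\mathcal H^{s,2}_\Lambda(\mathbb Z^n)=\{w\in\mathcal S'(\mathbb Z^n):\Lambda(D)^sw\in\ell^2(\mathbb Z^n)\}$, where $\Lambda(D)^s$ is the operator on $\mathcal S'(\mathbb Z^n)$ with symbol $(k,x)\mapsto\Lambda(k)^s$, i.e. $(\Lambda(D)^sw)(k)=\langle\widehat w,\Lambda(k)^se^{2\pi i k\cdot x}\rangle$ with $\widehat w\in\mathcal D'(\mathbb T^n)$ the Fourier transform of $w$, so that in effect $(\Lambda(D)^sw)(k)=\Lambda(k)^sw(k)$. **Theorem.** Let $\Lambda$ be a weight function on $\mathbb Z^n$ with top exponent $\mu$,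 let $m\in\mathbb R$, $0<\rho\le1/\mu$, and let $\sigma\in M^m_{\rho,\Lambda}(\mathbb Z^n\times\mathbb T^n)$ be $M$-elliptic. Then $$\mathrm{Dom}(T_{\sigma,0})=\mathcal H^{m,2}_\Lambda(\mathbb Z^n)\cap\ell^2(\mathbb Z^n).$$ In particular, if $m\ge0$, then $\mathrm{Dom}(T_{\sigma,0})=\mathcal H^{m,2}_\Lambda(\mathbb Z^n)$. -/

import Mathlib

open MeasureTheory Filter Topology
open scoped ContDiff

noncomputable section

namespace LatticePDO

/-- The lattice `ℤⁿ`. -/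
abbrev Lattice (n : ℕ) : Type := Fin n → ℤ

/-- The torus `𝕋ⁿ = ℝⁿ / ℤⁿ`. -/
abbrev Torus (n : ℕ) : Type := UnitAddTorus (Fin n)

/-- The Haar measure on `𝕋ⁿ`, normalised to total mass one. -/
def torusMeasure (n : ℕ) : Measure (Torus n) :=
  Measure.pi fun _ => (AddCircle.haarAddCircle : Measure UnitAddCircle)

/-- The Euclidean length `|k|` of a lattice point. -/
def euclNorm {n : ℕ} (k : Lattice n) : ℝ := √(∑ i, (k i : ℝ) ^ 2)

/-- The monomial `k^γ = k₁^γ₁ ⋯ kₙ^γₙ`. -/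
def monomial {n : ℕ} (γ : Fin n → ℕ) (k : Lattice n) : ℤ := ∏ i, k i ^ γ i

/-- The length `|α| = α₁ + ⋯ + αₙ` of a multi-index. -/
def multiLength {n : ℕ} (α : Fin n → ℕ) : ℕ := ∑ i, α i

/-- For families `T j ℓ` (`j` a coordinate, `ℓ` an order), the composition
`T 1 α₁ ∘ T 2 α₂ ∘ ⋯ ∘ T n αₙ`. -/
def multiComp {X : Type*} {n : ℕ} (T : Fin n → ℕ → X → X) (α : Fin n → ℕ) : X → X :=
  (List.ofFn fun j => T j (α j)).foldr (fun S R => S ∘ R) id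

/-! ### Difference operators on the lattice -/

/-- The forward difference `Δ_{k_j} f (k) = f (k + e_j) - f k`. -/
def diffOp {E : Type*} [AddCommGroup E] {n : ℕ} (j : Fin n) (f : Lattice n → E) :
    Lattice n → E :=
  fun k => f (k + Pi.single j 1) - f k

/-- `Δ_k^α = Δ_{k_1}^{α_1} ⋯ Δ_{k_n}^{α_n}`. -/
def multiDiff {E : Type*} [AddCommGroup E] {n : ℕ} (α : Fin n → ℕ) (f : Lattice n → E) :
    Lattice n → E :=
  multiComp (fun j ℓ => (diffOp j)^[ℓ]) α f

/-! ### Derivatives on the torus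

Functions on `𝕋ⁿ` are differentiated through their `ℤⁿ`-periodic lifts to `ℝⁿ`. -/

/-- The periodic lift to `ℝⁿ` of a function on `𝕋ⁿ`. -/
def torusLift {n : ℕ} (f : Torus n → ℂ) : (Fin n → ℝ) → ℂ :=
  fun t => f fun i => (t i : UnitAddCircle)

/-- `f ∈ C^∞(𝕋ⁿ)`. -/
def IsSmoothOnTorus {n : ℕ} (f : Torus n → ℂ) : Prop :=
  ContDiff ℝ ∞ (torusLift f)

/-- `D_{x_j} = (2πi)⁻¹ ∂/∂x_j`. -/
def partialD {n : ℕ} (j : Fin n) (g : (Fin n → ℝ) → ℂ) : (Fin n → ℝ) → ℂ :=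
  fun t => (2 * Real.pi * Complex.I)⁻¹ * fderiv ℝ g t (Pi.single j 1)

/-- `D_{x_j}^{(ℓ)} = D_{x_j} (D_{x_j} - 1) ⋯ (D_{x_j} - (ℓ - 1))`, with `D_{x_j}^{(0)} = I`. -/
def fallingD {n : ℕ} (j : Fin n) : ℕ → ((Fin n → ℝ) → ℂ) → (Fin n → ℝ) → ℂ
  | 0, g => g
  | ℓ + 1, g => fun t => partialD j (fallingD j ℓ g) t - (ℓ : ℂ) * fallingD j ℓ g t

/-- `D_x^{(β)} = D_{x_1}^{(β_1)} ⋯ D_{x_n}^{(β_n)}`. -/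
def multiD {n : ℕ} (β : Fin n → ℕ) (g : (Fin n → ℝ) → ℂ) : (Fin n → ℝ) → ℂ :=
  multiComp fallingD β g

/-! ### Weights and symbol classes -/

/-- `Λ` is a weight function on `ℤⁿ` with top exponent `μ`. -/
def IsWeight {n : ℕ} (μ : ℝ) (Λ : Lattice n → ℝ) : Prop :=
  (∃ μ₀ μ₁ C₀ C₁ : ℝ, 0 < μ₀ ∧ μ₀ ≤ μ₁ ∧ μ₁ ≤ μ ∧ 0 < C₀ ∧ 0 < C₁ ∧
    ∀ k, C₀ * (1 + euclNorm k) ^ μ₀ ≤ Λ k ∧ Λ k ≤ C₁ * (1 + euclNorm k) ^ μ₁) ∧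
  ∀ α γ : Fin n → ℕ, (∀ i, γ i ≤ 1) →
    ∃ C : ℝ, 0 < C ∧ ∀ k,
      |(monomial γ k : ℝ) * multiDiff (α + γ) Λ k| ≤
        C * Λ k ^ (1 - 1 / μ * (multiLength α : ℝ))

/-- A symbol: a function `σ(k, x)` on `ℤⁿ × 𝕋ⁿ`. -/
abbrev Symbol (n : ℕ) : Type := Lattice n → Torus n → ℂ

/-- The symbol class `S^m_{ρ,Λ}(ℤⁿ × 𝕋ⁿ)`. -/
def symbolS {n : ℕ} (m ρ : ℝ) (Λ : Lattice n → ℝ) : Set (Symbol n) :=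
  {σ | (∀ k, IsSmoothOnTorus (σ k)) ∧
    ∀ α β : Fin n → ℕ, ∃ C : ℝ, 0 < C ∧ ∀ (k : Lattice n) (t : Fin n → ℝ),
      ‖multiD β (torusLift (multiDiff α σ k)) t‖ ≤ C * Λ k ^ (m - ρ * (multiLength α : ℝ))}

/-- The symbol class `M^m_{ρ,Λ}(ℤⁿ × 𝕋ⁿ)`: symbols `σ`, smooth in `x`, such that
`k^γ Δ_k^γ σ(k, x)` is in `S^m_{ρ,Λ}` for all `γ ∈ {0,1}ⁿ`. -/
def symbolM {n : ℕ} (m ρ : ℝ) (Λ : Lattice n → ℝ) : Set (Symbol n) :=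
  {σ | (∀ k, IsSmoothOnTorus (σ k)) ∧
    ∀ γ : Fin n → ℕ, (∀ i, γ i ≤ 1) →
      (fun k x => (monomial γ k : ℂ) * multiDiff γ σ k x) ∈ symbolS m ρ Λ}

/-- `M`-ellipticity of order `m`: `|σ(k, x)| ≥ C Λ(k)^m` for all `x` and all `|k| ≥ R`. -/
def IsMElliptic {n : ℕ} (m : ℝ) (Λ : Lattice n → ℝ) (σ : Symbol n) : Prop :=
  ∃ C R : ℝ, 0 < C ∧ 0 < R ∧
    ∀ (k : Lattice n) (x : Torus n), R ≤ euclNorm k → C * Λ k ^ m ≤ ‖σ k x‖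

/-! ### Sequences, Fourier transform, pseudo-differential operators -/

/-- The Schwartz space `𝓢(ℤⁿ)` of rapidly decreasing functions. -/
def IsSchwartz {n : ℕ} (f : Lattice n → ℂ) : Prop :=
  ∀ N : ℕ, ∃ C : ℝ, ∀ k, (1 + euclNorm k) ^ N * ‖f k‖ ≤ C

/-- The space `𝓢'(ℤⁿ)` of tempered distributions: the functions of polynomial growth. -/
def IsTempered {n : ℕ} (w : Lattice n → ℂ) : Prop :=
  ∃ (N : ℕ) (C : ℝ), ∀ k, ‖w k‖ ≤ C * (1 + euclNorm k) ^ N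

/-- The space `ℓ²(ℤⁿ)`. -/
abbrev ellTwo (n : ℕ) : Type := lp (fun _ : Lattice n => ℂ) 2

/-- The Fourier transform `f̂(x) = ∑_k e^{-2πi k·x} f(k)`. -/
def fourierLattice {n : ℕ} (f : Lattice n → ℂ) (x : Torus n) : ℂ :=
  ∑' k, UnitAddTorus.mFourier (-k) x * f k

/-- The inverse transform `(𝓕⁻¹ u)(k) = ∫ e^{2πi k·x} u(x) dx`. -/
def fourierLatticeInv {n : ℕ} (u : Torus n → ℂ) (k : Lattice n) : ℂ :=
  ∫ x, UnitAddTorus.mFourier k x * u x ∂torusMeasure n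

/-- The pseudo-differential operator
`T_σ f(k) = ∫ e^{2πi k·x} σ(k, x) f̂(x) dx`, for `f ∈ 𝓢(ℤⁿ)`. -/
def pseudoDiff {n : ℕ} (σ : Symbol n) (f : Lattice n → ℂ) (k : Lattice n) : ℂ :=
  ∫ x, UnitAddTorus.mFourier k x * σ k x * fourierLattice f x ∂torusMeasure n

/-- For `w ∈ 𝓢'(ℤⁿ)`, the distribution `𝓕 w ∈ 𝓓'(𝕋ⁿ)`:
`⟨𝓕 w, u⟩ = ⟨w, p ∘ 𝓕⁻¹ u⟩` for `u ∈ C^∞(𝕋ⁿ)`, where `(p ∘ v)(k) = v(-k)`. -/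
def fourierDistribution {n : ℕ} (w : Lattice n → ℂ) (u : Torus n → ℂ) : ℂ :=
  ∑' k, w k * fourierLatticeInv u (-k)

/-- `T_σ` on `𝓢'(ℤⁿ)`: the integral against `f̂` is replaced by the pairing with `𝓕 w`, i.e.
`(T_σ w)(k) = ⟨𝓕 w, e^{2πi k·x} σ(k, x)⟩`. -/
def pseudoDiffDistribution {n : ℕ} (σ : Symbol n) (w : Lattice n → ℂ) (k : Lattice n) : ℂ :=
  fourierDistribution w fun x => UnitAddTorus.mFourier k x * σ k x

/-- `Λ(D)^s = 𝓕⁻¹ Λ^s 𝓕` on `𝓢'(ℤⁿ)`, the operator with symbol `(k, x) ↦ Λ(k)^s`. -/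
def weightPowD {n : ℕ} (Λ : Lattice n → ℝ) (s : ℝ) (w : Lattice n → ℂ) : Lattice n → ℂ :=
  pseudoDiffDistribution (fun k _ => ((Λ k ^ s : ℝ) : ℂ)) w

/-- The weighted Sobolev space `𝓗^{s,2}_Λ(ℤⁿ) = {w ∈ 𝓢'(ℤⁿ) : Λ(D)^s w ∈ ℓ²(ℤⁿ)}`. -/
def weightedSobolev {n : ℕ} (s : ℝ) (Λ : Lattice n → ℝ) : Set (Lattice n → ℂ) :=
  {w | IsTempered w ∧ Memℓp (weightPowD Λ s w) 2}

/-- The graph of the minimal operator `T_{σ,0}`: `(g, f)` belongs to it when there are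
`φ_j ∈ 𝓢(ℤⁿ)` with `φ_j → g` and `T_σ φ_j → f` in `ℓ²(ℤⁿ)`. -/
def minimalGraph {n : ℕ} (σ : Symbol n) : Set (ellTwo n × ellTwo n) :=
  {p | ∃ φ ψ : ℕ → ellTwo n,
    (∀ j, IsSchwartz (φ j : Lattice n → ℂ)) ∧
    (∀ j, (ψ j : Lattice n → ℂ) = pseudoDiff σ (φ j : Lattice n → ℂ)) ∧
    Tendsto φ atTop (𝓝 p.1) ∧ Tendsto ψ atTop (𝓝 p.2)}

/-- The domain of the minimal operator `T_{σ,0}` on `ℓ²(ℤⁿ)`. -/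
def minimalDomain {n : ℕ} (σ : Symbol n) : Set (ellTwo n) :=
  {g | ∃ f, (g, f) ∈ minimalGraph σ}

end LatticePDO

end

noncomputable section

namespace LatticePDO

/-! ### The `ℓ¹` size of a lattice point -/

/-! Let a_k(i) be the Fourier coefficients of σ(k, ·). On rapidly decreasing f, `T_σ` is the
convolution with variable coefficients (T_σ f)(k) = ∑_i a_k(i) f(k - i), and `Λ(D)^m` is
multiplication by Λ^m. The theorem thus compares the ℓ² norms of Λ^m f, T_σ f and f.

Two facts about the kernel are needed. The x-derivatives of σ(k, ·)/Λ(k)^m are bounded uniformly in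
k, so |a_k(i)| is at most Λ(k)^m times any prescribed negative power of 1 + |i|. Peetre's inequality
(`IsWeight.exists_rpow_add_le`) lets Λ^s move from one point to another at the cost of a polynomial
in the displacement, which the decay absorbs. With Young's inequality this gives ‖T_σ f‖ ≤ C ‖Λ^m f‖
(`exists_sqSum_latticeOp_le`). Truncating u to finite sets then converges in ℓ² and in the weighted
norm, so T_σ converges along the truncations and u lies in the minimal domain.

The other inclusion rests on the estimate ‖Λ^m f‖ ≤ C (‖T_σ f‖ + ‖f‖) for Schwartz f
(`exists_elliptic_estimate`), which passes to limits by Fatou's lemma. To prove it, freeze the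
symbol at k with |k| ≥ R and let b_k be the Fourier coefficients of 1/σ(k, ·). Then f(k) = ∑_j
b_k(j) ∑_i a_k(i) f(k - j - i) exactly. Replacing a_k by a_{k-j} turns the inner sum into (T_σ f)(k
- j); the error a_{k-j} - a_k telescopes into lattice differences of σ and gains a factor Λ^{-ρ}.
Since Λ^{m-ρ} ≤ εΛ^m + C_ε, the error is absorbed on the left. -/

/-- The `ℓ¹` length of a lattice point. -/
def latticeSize {n : ℕ} (k : Lattice n) : ℕ := ∑ i, (k i).natAbs

/-- The bracket `1 + |k|₁`. -/
def bracket {n : ℕ} (k : Lattice n) : ℝ := 1 + latticeSize k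

lemma one_le_bracket {n : ℕ} (k : Lattice n) : 1 ≤ bracket k := by
  simp [bracket]

lemma bracket_pos {n : ℕ} (k : Lattice n) : 0 < bracket k :=
  zero_lt_one.trans_le (one_le_bracket k)

lemma latticeSize_neg {n : ℕ} (k : Lattice n) : latticeSize (-k) = latticeSize k := by
  simp [latticeSize]

lemma bracket_neg {n : ℕ} (k : Lattice n) : bracket (-k) = bracket k := by
  simp [bracket, latticeSize_neg]

lemma latticeSize_add_le {n : ℕ} (j k : Lattice n) :
    latticeSize (j + k) ≤ latticeSize j + latticeSize k := by
  unfold latticeSize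
  rw [← Finset.sum_add_distrib]
  exact Finset.sum_le_sum fun i _ => Int.natAbs_add_le _ _

lemma bracket_add_le {n : ℕ} (j k : Lattice n) : bracket (j + k) ≤ bracket j * bracket k := by
  have h : (latticeSize (j + k) : ℝ) ≤ latticeSize j + latticeSize k := by
    exact_mod_cast latticeSize_add_le j k
  have : (0 : ℝ) ≤ latticeSize j * latticeSize k := by positivity
  unfold bracket
  nlinarith

lemma latticeSize_le_bracket {n : ℕ} (j : Lattice n) : (latticeSize j : ℝ) ≤ bracket j := by
  simp [bracket]

lemma latticeSize_add_single {n : ℕ} (j : Lattice n) (i : Fin n) :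
    (latticeSize (j + Pi.single i 1) : ℤ) = latticeSize j + |j i + 1| - |j i| := by
  unfold latticeSize
  rw [← Finset.add_sum_erase _ _ (Finset.mem_univ i), ← Finset.add_sum_erase _ _ (Finset.mem_univ i)]
  have : ∑ x ∈ Finset.univ.erase i, ((j + Pi.single i 1 : Lattice n) x).natAbs =
      ∑ x ∈ Finset.univ.erase i, (j x).natAbs := by
    refine Finset.sum_congr rfl fun x hx => ?_
    simp [Finset.ne_of_mem_erase hx]
  rw [this]
  push_cast
  simp
  ring

/-- Telescoping along a lattice path from `k` to `k + j`. Induction on the `ℓ¹` length moves one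
nonzero coordinate of `j` towards zero, so the path never leaves the ball of radius `N` about `k`. A
negative coordinate is handled by traversing a forward step backwards. -/
lemma norm_sub_le_of_step {E : Type*} [SeminormedAddCommGroup E] {n : ℕ} (F : Lattice n → E)
    {W : ℝ} (N : ℕ) (k : Lattice n)
    (h : ∀ j, latticeSize j ≤ N → ∀ i, ‖F (k + j + Pi.single i 1) - F (k + j)‖ ≤ W) :
    ∀ j, latticeSize j ≤ N → ‖F (k + j) - F k‖ ≤ latticeSize j * W := by
  suffices H : ∀ (D : ℕ) (j : Lattice n), latticeSize j = D → D ≤ N →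
      ‖F (k + j) - F k‖ ≤ D * W from fun j hj => H _ j rfl hj
  intro D
  induction D with
  | zero =>
    intro j hj _
    have : j = 0 := by
      ext i
      simpa [latticeSize] using (Finset.sum_eq_zero_iff.mp hj) i (Finset.mem_univ i)
    simp [this]
  | succ D ih =>
    intro j hj hD
    have : ∃ i, j i ≠ 0 := by
      by_contra! h0
      simp [latticeSize, h0] at hj
    obtain ⟨i, hi⟩ := this
    rcases lt_or_gt_of_ne hi with hneg | hpos
    · have hs : latticeSize (j + Pi.single i 1) = D := by
        have := latticeSize_add_single j i
        rw [abs_of_nonpos (by omega : j i + 1 ≤ 0), abs_of_neg hneg] at this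
        omega
      have h1 := ih _ hs (by omega)
      have h2 := h j (by omega) i
      rw [add_assoc] at h2
      calc ‖F (k + j) - F k‖
          = ‖(F (k + (j + Pi.single i 1)) - F k) - (F (k + (j + Pi.single i 1)) - F (k + j))‖ := by
            congr 1; abel
        _ ≤ _ := norm_sub_le _ _
        _ ≤ D * W + W := add_le_add h1 h2
        _ = _ := by push_cast; ring
    · obtain ⟨j', rfl⟩ : ∃ j', j = j' + Pi.single i 1 := ⟨j - Pi.single i 1, by abel⟩
      have hs : latticeSize j' = D := by
        have := latticeSize_add_single j' i
        simp at hpos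
        rw [abs_of_nonneg (by omega : 0 ≤ j' i + 1), abs_of_nonneg (by omega)] at this
        omega
      have h1 := ih _ hs (by omega)
      have h2 := h j' (by omega) i
      rw [add_assoc] at h2
      calc ‖F (k + (j' + Pi.single i 1)) - F k‖
          = ‖(F (k + j') - F k) + (F (k + (j' + Pi.single i 1)) - F (k + j'))‖ := by
            congr 1; abel
        _ ≤ _ := norm_add_le _ _
        _ ≤ D * W + W := add_le_add h1 h2
        _ = _ := by push_cast; ring

/-! ### Multi-index operators at simple multi-indices -/

lemma foldr_comp_ofFn_eq_id {X : Type*} {n : ℕ} (S : Fin n → X → X) (h : ∀ j, S j = id) :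
    (List.ofFn S).foldr (fun S R => S ∘ R) id = id := by
  induction n with
  | zero => simp
  | succ n ih =>
    rw [List.ofFn_succ, List.foldr_cons, ih _ fun j => h j.succ, h 0]
    rfl

/-- Only the multi-indices 0 and multiples of a unit vector are evaluated below; for them the
composition collapses to a single factor. -/
lemma foldr_comp_ofFn_eq {X : Type*} {n : ℕ} (S : Fin n → X → X) (i : Fin n)
    (h : ∀ j, j ≠ i → S j = id) : (List.ofFn S).foldr (fun S R => S ∘ R) id = S i := by
  induction n with
  | zero => exact i.elim0
  | succ n ih =>
    rw [List.ofFn_succ, List.foldr_cons]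
    cases i using Fin.cases with
    | zero => rw [foldr_comp_ofFn_eq_id _ fun j => h _ (Fin.succ_ne_zero j)]; rfl
    | succ i =>
      rw [ih _ i fun j hj => h _ fun he => hj (Fin.succ_injective _ he),
        h 0 (Fin.succ_ne_zero i).symm]
      rfl

lemma multiComp_of_forall_ne {X : Type*} {n : ℕ} (T : Fin n → ℕ → X → X) (α : Fin n → ℕ)
    (i : Fin n) (h : ∀ j, j ≠ i → T j (α j) = id) : multiComp T α = T i (α i) :=
  foldr_comp_ofFn_eq (fun j => T j (α j)) i h

lemma multiComp_zero {X : Type*} {n : ℕ} (T : Fin n → ℕ → X → X) (h : ∀ j, T j 0 = id) :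
    multiComp T 0 = id := by
  rcases n with _ | n
  · simp [multiComp]
  · rw [multiComp_of_forall_ne T 0 0 fun j _ => h j]
    exact h 0

lemma multiDiff_zero {E : Type*} [AddCommGroup E] {n : ℕ} (f : Lattice n → E) :
    multiDiff 0 f = f := by
  unfold multiDiff
  rw [multiComp_zero _ fun j => rfl]
  rfl

lemma multiDiff_single {E : Type*} [AddCommGroup E] {n : ℕ} (i : Fin n) (f : Lattice n → E) :
    multiDiff (Pi.single i 1) f = diffOp i f := by
  unfold multiDiff
  rw [multiComp_of_forall_ne _ _ i fun j hj => by simp [hj]]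
  simp

lemma multiD_single {n : ℕ} (i : Fin n) (N : ℕ) (g : (Fin n → ℝ) → ℂ) :
    multiD (Pi.single i N) g = fallingD i N g := by
  unfold multiD
  rw [multiComp_of_forall_ne _ _ i fun j hj => by simp only [Pi.single_eq_of_ne hj]; rfl]
  simp

lemma multiLength_single {n : ℕ} (i : Fin n) : multiLength (Pi.single i 1 : Fin n → ℕ) = 1 := by
  simp [multiLength]

lemma multiLength_zero {n : ℕ} : multiLength (0 : Fin n → ℕ) = 0 := by simp [multiLength]

lemma monomial_zero {n : ℕ} (k : Lattice n) : monomial 0 k = 1 := by simp [monomial]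

lemma exists_uniform_bound {ι : Type*} [Fintype ι] (P : ι → ℝ → Prop)
    (hmono : ∀ i C C', C ≤ C' → P i C → P i C') (h : ∀ i, ∃ C, 0 < C ∧ P i C) :
    ∃ C, 0 < C ∧ ∀ i, P i C := by
  choose C hC hP using h
  -- The summand 1 keeps the constant positive when `ι` is empty.
  refine ⟨1 + ∑ i, C i, ?_, fun i => hmono i _ _ ?_ (hP i)⟩
  · have := Finset.sum_nonneg fun i (_ : i ∈ Finset.univ) => (hC i).le
    linarith
  · have := Finset.single_le_sum (fun i (_ : i ∈ Finset.univ) => (hC i).le) (Finset.mem_univ i)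
    linarith

/-! ### Elementary inequalities for real powers -/

lemma exists_rpow_le_of_mem_Icc {c : ℝ} (hc : 0 < c) (M s : ℝ) :
    ∃ B, 0 < B ∧ ∀ x, c ≤ x → x ≤ M → x ^ s ≤ B := by
  refine ⟨c ^ s + |M| ^ s + 1, by positivity, fun x hx hM => ?_⟩
  have hx0 : 0 < x := hc.trans_le hx
  have hM' : x ≤ |M| := hM.trans (le_abs_self M)
  have h0 : 0 ≤ |M| ^ s := by positivity
  have h1 : 0 ≤ c ^ s := by positivity
  rcases le_total 0 s with hs | hs
  · have := Real.rpow_le_rpow hx0.le hM' hs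
    linarith
  · have := Real.rpow_le_rpow_of_nonpos hc hx hs
    linarith

lemma exists_abs_rpow_sub_one_le {K : ℝ} (hK : 1 ≤ K) (p : ℝ) :
    ∃ L, 0 < L ∧ ∀ z, K⁻¹ ≤ z → z ≤ K → |z ^ p - 1| ≤ L * |z - 1| := by
  have hK0 : 0 < K := by linarith
  obtain ⟨B, hB, hB'⟩ := exists_rpow_le_of_mem_Icc (inv_pos.mpr hK0) K (p - 1)
  refine ⟨(|p| + 1) * B, by positivity, fun z hz hzK => ?_⟩
  have hd : ∀ x ∈ Set.Icc K⁻¹ K, HasDerivWithinAt (fun x : ℝ => x ^ p) (p * x ^ (p - 1))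
      (Set.Icc K⁻¹ K) x := fun x hx =>
    (Real.hasDerivAt_rpow_const (Or.inl ((inv_pos.mpr hK0).trans_le hx.1).ne')).hasDerivWithinAt
  have := (convex_Icc K⁻¹ K).norm_image_sub_le_of_norm_hasDerivWithin_le (C := (|p| + 1) * B) hd
    (fun x hx => by
      have hx0 : 0 < x := (inv_pos.mpr hK0).trans_le hx.1
      have h1 := hB' x hx.1 hx.2
      have h2 : 0 ≤ x ^ (p - 1) := by positivity
      rw [norm_mul, Real.norm_eq_abs, Real.norm_of_nonneg h2]
      have := abs_nonneg p
      nlinarith [mul_le_mul_of_nonneg_left h1 this])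
    (x := 1) (y := z) ⟨inv_le_one_of_one_le₀ hK, hK⟩ ⟨hz, hzK⟩
  simpa using this

/-- A discrete form of d(x^p) = p x^{p-1} dx: an increment of size x^{1-p} changes x^p by a bounded
amount. The ratio y/x stays in a compact interval [1/K, K] of the positive axis, where z ↦ z^p is
Lipschitz, and x^p times |y/x - 1| ≤ C x^{-p} is bounded. -/
lemma exists_abs_rpow_sub_rpow_le {c C p : ℝ} (hc : 0 < c) (hC : 0 < C) (hp : 0 < p) :
    ∃ L, 0 < L ∧ ∀ x y, c ≤ x → c ≤ y → |y - x| ≤ C * x ^ (1 - p) → |y ^ p - x ^ p| ≤ L := by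
  -- Beyond `M` the relative increment C x^{-p} is at most 1/2, so y/x ≥ 1/2; below `M`, y/x ≥ c/M.
  -- The three terms of `K` cover these two lower bounds and the upper bound 1 + C c^{-p}.
  set M : ℝ := (2 * C) ^ p⁻¹ with hM
  have hMp : M ^ p = 2 * C := Real.rpow_inv_rpow (by positivity) hp.ne'
  have hM0 : 0 < M := by positivity
  set K : ℝ := 2 + M / c + C * c ^ (-p) with hK
  have hK1 : 1 ≤ K := by
    have : 0 < M / c := by positivity
    have : 0 < C * c ^ (-p) := by positivity
    linarith
  have hK0 : 0 < K := by linarith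
  obtain ⟨L, hL, hL'⟩ := exists_abs_rpow_sub_one_le hK1 p
  refine ⟨L * C, by positivity, fun x y hx hy h => ?_⟩
  have hx0 : 0 < x := hc.trans_le hx
  have hy0 : 0 < y := hc.trans_le hy
  have hxp : x ^ (1 - p) = x * x ^ (-p) := by
    rw [sub_eq_add_neg, Real.rpow_add hx0, Real.rpow_one]
  have hz : |y / x - 1| ≤ C * x ^ (-p) := by
    rw [div_sub_one hx0.ne', abs_div, abs_of_pos hx0, div_le_iff₀ hx0]
    calc _ ≤ _ := h
      _ = _ := by rw [hxp]; ring
  have hxc : x ^ (-p) ≤ c ^ (-p) := Real.rpow_le_rpow_of_nonpos hc hx (by linarith)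
  have hup : y / x ≤ K := by
    have h1 := (abs_le.mp hz).2
    have h2 := mul_le_mul_of_nonneg_left hxc hC.le
    have : 0 < M / c := by positivity
    linarith
  have hlow : K⁻¹ ≤ y / x := by
    rcases le_total x M with hxM | hxM
    · rw [inv_le_comm₀ hK0 (by positivity), inv_div]
      have : x / y ≤ M / c := by gcongr
      have : 0 < C * c ^ (-p) := by positivity
      linarith
    · have h1 := (abs_le.mp hz).1
      have h2 : x ^ (-p) ≤ M ^ (-p) := Real.rpow_le_rpow_of_nonpos hM0 hxM (by linarith)
      rw [Real.rpow_neg hM0.le, hMp] at h2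
      have h3 : C * x ^ (-p) ≤ 1 / 2 := by
        calc _ ≤ C * (2 * C)⁻¹ := by gcongr
          _ = 1 / 2 := by field_simp
      have h4 : K⁻¹ ≤ 2⁻¹ := by
        apply inv_anti₀ (by norm_num)
        have : 0 < M / c := by positivity
        have : 0 < C * c ^ (-p) := by positivity
        linarith
      norm_num at h4
      linarith
  have key := hL' _ hlow hup
  have hsplit : y ^ p - x ^ p = x ^ p * ((y / x) ^ p - 1) := by
    rw [Real.div_rpow hy0.le hx0.le]
    field_simp
  rw [hsplit, abs_mul, abs_of_pos (Real.rpow_pos_of_pos hx0 p)]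
  calc x ^ p * |(y / x) ^ p - 1| ≤ x ^ p * (L * (C * x ^ (-p))) := by gcongr; exact key.trans (by gcongr)
    _ = L * C * (x ^ p * x ^ (-p)) := by ring
    _ = L * C := by rw [← Real.rpow_add hx0]; simp

/-! ### Weights -/

lemma one_le_one_add_euclNorm {n : ℕ} (k : Lattice n) : 1 ≤ 1 + euclNorm k := by
  simp [euclNorm, Real.sqrt_nonneg]

lemma IsWeight.pos_exponent {n : ℕ} {μ : ℝ} {Λ : Lattice n → ℝ} (h : IsWeight μ Λ) : 0 < μ := by
  obtain ⟨⟨μ₀, μ₁, _, _, h0, h1, h2, _⟩, _⟩ := h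
  linarith

lemma IsWeight.exists_le {n : ℕ} {μ : ℝ} {Λ : Lattice n → ℝ} (h : IsWeight μ Λ) :
    ∃ c, 0 < c ∧ ∀ k, c ≤ Λ k := by
  obtain ⟨⟨μ₀, μ₁, C₀, _, h0, h1, h2, hC, _, hk⟩, _⟩ := h
  refine ⟨C₀, hC, fun k => le_trans ?_ (hk k).1⟩
  exact le_mul_of_one_le_right hC.le (Real.one_le_rpow (one_le_one_add_euclNorm k) h0.le)

lemma IsWeight.pos {n : ℕ} {μ : ℝ} {Λ : Lattice n → ℝ} (h : IsWeight μ Λ) (k : Lattice n) :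
    0 < Λ k := by
  obtain ⟨c, hc, hk⟩ := h.exists_le
  exact hc.trans_le (hk k)

lemma IsWeight.exists_abs_sub_le {n : ℕ} {μ : ℝ} {Λ : Lattice n → ℝ} (h : IsWeight μ Λ) :
    ∃ C, 0 < C ∧ ∀ i k, |Λ (k + Pi.single i 1) - Λ k| ≤ C * Λ k ^ (1 - μ⁻¹) := by
  refine exists_uniform_bound _ (fun i C C' hC hP k => (hP k).trans ?_) fun i => ?_
  · have := Real.rpow_nonneg (h.pos k).le (1 - μ⁻¹)
    gcongr
  · obtain ⟨C, hC, hk⟩ := h.2 (Pi.single i 1) 0 (by simp)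
    refine ⟨C, hC, fun k => ?_⟩
    have := hk k
    rw [monomial_zero, add_zero, multiDiff_single, multiLength_single] at this
    simpa [diffOp] using this

/-- The first-order difference bound on Λ says exactly that Λ^{1/μ} has bounded increments, so it
grows at most linearly along lattice paths. The lower bound Λ ≥ c turns the additive constant into a
multiplicative one. -/
lemma IsWeight.exists_rpow_inv_add_le {n : ℕ} {μ : ℝ} {Λ : Lattice n → ℝ} (h : IsWeight μ Λ) :
    ∃ C, 1 ≤ C ∧ ∀ k j, Λ (k + j) ^ μ⁻¹ ≤ C * bracket j * Λ k ^ μ⁻¹ := by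
  obtain ⟨c, hc, hck⟩ := h.exists_le
  obtain ⟨C, hC, hCk⟩ := h.exists_abs_sub_le
  have hμ := h.pos_exponent
  obtain ⟨L, hL, hL'⟩ := exists_abs_rpow_sub_rpow_le hc hC (inv_pos.mpr hμ)
  refine ⟨1 + L / c ^ μ⁻¹, by have : 0 < L / c ^ μ⁻¹ := by positivity
                              linarith, fun k j => ?_⟩
  have hstep := norm_sub_le_of_step (fun k => Λ k ^ μ⁻¹) (W := L) (latticeSize j) k
    (fun j _ i => hL' _ _ (hck _) (hck _) (hCk i _)) j le_rfl
  have h1 := (le_abs_self _).trans hstep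
  have h2 : c ^ μ⁻¹ ≤ Λ k ^ μ⁻¹ := Real.rpow_le_rpow hc.le (hck k) (inv_pos.mpr hμ).le
  have hcp : 0 < c ^ μ⁻¹ := by positivity
  have h3 : L ≤ L / c ^ μ⁻¹ * Λ k ^ μ⁻¹ := by
    rw [div_mul_eq_mul_div, le_div_iff₀ hcp]
    gcongr
  have h4 := one_le_bracket j
  have h5 := latticeSize_le_bracket j
  have h6 : 0 < Λ k ^ μ⁻¹ := hcp.trans_le h2
  have h7 : latticeSize j * L ≤ bracket j * (L / c ^ μ⁻¹ * Λ k ^ μ⁻¹) := by gcongr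
  have h8 : Λ k ^ μ⁻¹ ≤ bracket j * Λ k ^ μ⁻¹ := le_mul_of_one_le_left h6.le h4
  calc Λ (k + j) ^ μ⁻¹ ≤ Λ k ^ μ⁻¹ + latticeSize j * L := by linarith
    _ ≤ _ := by linarith

/-- Peetre's inequality for weight functions. -/
lemma IsWeight.exists_rpow_add_le {n : ℕ} {μ : ℝ} {Λ : Lattice n → ℝ} (h : IsWeight μ Λ) (s : ℝ) :
    ∃ C, 0 < C ∧ ∃ Q : ℕ, ∀ k j, Λ (k + j) ^ s ≤ C * bracket j ^ Q * Λ k ^ s := by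
  obtain ⟨C, hC, hk⟩ := h.exists_rpow_inv_add_le
  have hμ := h.pos_exponent
  have hC0 : 0 < C := by linarith
  obtain ⟨Q, hQ⟩ := exists_nat_ge (μ * |s|)
  refine ⟨C ^ (μ * |s|), by positivity, Q, fun k j => ?_⟩
  have hpow : ∀ {x : ℝ}, 0 < x → (x ^ μ⁻¹) ^ (μ * |s|) = x ^ |s| := fun {x} hx => by
    rw [← Real.rpow_mul hx.le, ← mul_assoc, inv_mul_cancel₀ hμ.ne', one_mul]
  have hmain : ∀ k j, Λ (k + j) ^ |s| ≤ C ^ (μ * |s|) * bracket j ^ Q * Λ k ^ |s| := fun k j => by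
    have h1 := Real.rpow_le_rpow (by have := h.pos (k + j); positivity) (hk k j)
      (by positivity : 0 ≤ μ * |s|)
    have hb := bracket_pos j
    have hp := h.pos k
    rw [hpow (h.pos _), Real.mul_rpow (by positivity) (by positivity), hpow hp,
      Real.mul_rpow (by positivity) (by positivity)] at h1
    refine h1.trans ?_
    gcongr
    rw [← Real.rpow_natCast]
    exact Real.rpow_le_rpow_of_exponent_le (one_le_bracket j) hQ
  rcases le_total 0 s with hs | hs
  · rw [abs_of_nonneg hs] at hmain ⊢
    exact hmain k j
  -- For negative `s`, exchange the two endpoints and take reciprocals.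
  · have h2 := hmain (k + j) (-j)
    rw [bracket_neg, add_neg_cancel_right, abs_of_nonpos hs, Real.rpow_neg (h.pos _).le,
      Real.rpow_neg (h.pos _).le] at h2
    rw [abs_of_nonpos hs]
    have hp1 := Real.rpow_pos_of_pos (h.pos k) s
    have hp2 := Real.rpow_pos_of_pos (h.pos (k + j)) s
    rw [← div_eq_mul_inv, le_div_iff₀ hp2, ← div_eq_inv_mul, div_le_iff₀ hp1] at h2
    exact h2

lemma IsWeight.exists_rpow_le {n : ℕ} {μ : ℝ} {Λ : Lattice n → ℝ} (h : IsWeight μ Λ) (s : ℝ) :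
    ∃ C, 0 < C ∧ ∃ Q : ℕ, ∀ k, Λ k ^ s ≤ C * bracket k ^ Q := by
  obtain ⟨C, hC, Q, hk⟩ := h.exists_rpow_add_le s
  have := Real.rpow_pos_of_pos (h.pos 0) s
  refine ⟨C * Λ 0 ^ s, by positivity, Q, fun k => ?_⟩
  have := hk 0 k
  rw [zero_add] at this
  linarith

/-! ### Families of smooth functions of one variable with uniformly bounded derivatives -/

lemma exists_bound_iteratedDeriv_mul {ι : Type*} {g h : ι → ℝ → ℂ} (hg : ∀ i, ContDiff ℝ ∞ (g i))
    (hh : ∀ i, ContDiff ℝ ∞ (h i)) (N : ℕ)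
    (bg : ∀ M ≤ N, ∃ B, ∀ i s, ‖iteratedDeriv M (g i) s‖ ≤ B)
    (bh : ∀ M ≤ N, ∃ B, ∀ i s, ‖iteratedDeriv M (h i) s‖ ≤ B) :
    ∀ M ≤ N, ∃ B, ∀ i s, ‖iteratedDeriv M (g i * h i) s‖ ≤ B := by
  intro M hM
  choose! Bg hBg using bg
  choose! Bh hBh using bh
  refine ⟨∑ l ∈ Finset.range (M + 1), M.choose l * Bg l * Bh (M - l), fun i s => ?_⟩
  rw [iteratedDeriv_mul ((hg i).of_le (by exact_mod_cast le_top)).contDiffAt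
    ((hh i).of_le (by exact_mod_cast le_top)).contDiffAt]
  refine (norm_sum_le _ _).trans (Finset.sum_le_sum fun l hl => ?_)
  rw [Finset.mem_range] at hl
  rw [norm_mul, norm_mul, Complex.norm_natCast]
  have h1 := hBg l (by omega) i s
  have h2 := hBh (M - l) (by omega) i s
  have h3 := (norm_nonneg _).trans h1
  gcongr

/-- Induction on the order through (1/g)' = -g' · (1/g) · (1/g): by the Leibniz rule, order N + 1 of
the inverse is controlled by its orders up to N. -/
lemma exists_bound_iteratedDeriv_inv {ι : Type*} {g : ι → ℝ → ℂ} (hg : ∀ i, ContDiff ℝ ∞ (g i))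
    (bg : ∀ M, ∃ B, ∀ i s, ‖iteratedDeriv M (g i) s‖ ≤ B) {c : ℝ} (hc : 0 < c)
    (hgc : ∀ i s, c ≤ ‖g i s‖) (N : ℕ) :
    ∀ M ≤ N, ∃ B, ∀ i s, ‖iteratedDeriv M (g i)⁻¹ s‖ ≤ B := by
  have hne : ∀ i s, g i s ≠ 0 := fun i s h => by
    have := hgc i s
    rw [h, norm_zero] at this
    linarith
  have hinv : ∀ i, ContDiff ℝ ∞ (g i)⁻¹ := fun i => (hg i).inv (hne i)
  induction N with
  | zero =>
    intro M hM
    obtain rfl : M = 0 := by omega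
    refine ⟨c⁻¹, fun i s => ?_⟩
    rw [iteratedDeriv_zero, Pi.inv_apply, norm_inv]
    exact inv_anti₀ hc (hgc i s)
  | succ N ih =>
    intro M hM
    rcases Nat.lt_or_ge M (N + 1) with h | h
    · exact ih M (by omega)
    · obtain rfl : M = N + 1 := by omega
      have hd : ∀ i, ContDiff ℝ ∞ (deriv (g i)) := fun i =>
        ((contDiff_infty_iff_deriv (𝕜 := ℝ)).mp (hg i)).2
      have hb := exists_bound_iteratedDeriv_mul hd (fun i => (hinv i).mul (hinv i)) N
        (fun M _ => by
          obtain ⟨B, hB⟩ := bg (M + 1)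
          exact ⟨B, fun i s => by simpa [iteratedDeriv_succ'] using hB i s⟩)
        (exists_bound_iteratedDeriv_mul hinv hinv N ih ih)
      obtain ⟨B, hB⟩ := hb N le_rfl
      refine ⟨B, fun i s => ?_⟩
      have : deriv (g i)⁻¹ = -(deriv (g i) * ((g i)⁻¹ * (g i)⁻¹)) := by
        ext s
        have := (((hg i).differentiable (by simp)) s).hasDerivAt.inv (hne i s)
        rw [this.deriv]
        simp only [Pi.neg_apply, Pi.mul_apply, Pi.inv_apply]
        field_simp
      rw [iteratedDeriv_succ', this, iteratedDeriv_neg, norm_neg]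
      exact hB i s

lemma norm_fwdDiff_iter_le {N : ℕ} {g : ℝ → ℂ} (hg : ContDiff ℝ ∞ g) {B : ℝ}
    (hB : ∀ s, ‖iteratedDeriv N g s‖ ≤ B) (h s : ℝ) : ‖(fwdDiff h)^[N] g s‖ ≤ |h| ^ N * B := by
  induction N generalizing g B s with
  | zero => simpa using hB s
  | succ N ih =>
    have hs : ContDiff ℝ ∞ fun z => g (z + h) := hg.comp (contDiff_id.add contDiff_const)
    have hf : ContDiff ℝ ∞ (fwdDiff h g) := hs.sub hg
    rw [Function.iterate_succ_apply, pow_succ, mul_assoc]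
    -- The induction hypothesis is applied to the first difference, whose N-th derivative is at most
    -- |h| B by the mean value inequality.
    refine ih hf (fun r => ?_) s
    have he : iteratedDeriv N (fwdDiff h g) r = iteratedDeriv N g (r + h) - iteratedDeriv N g r := by
      have : fwdDiff h g = (fun z => g (z + h)) - g := rfl
      rw [this, iteratedDeriv_sub (hs.of_le (by exact_mod_cast le_top)).contDiffAt
        (hg.of_le (by exact_mod_cast le_top)).contDiffAt, iteratedDeriv_comp_add_const]
    rw [he]
    have hdiff : Differentiable ℝ (iteratedDeriv N g) :=
      hg.differentiable_iteratedDeriv N (by exact_mod_cast WithTop.coe_lt_top _)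
    have := convex_univ.norm_image_sub_le_of_norm_deriv_le (f := iteratedDeriv N g) (C := B)
      (fun x _ => hdiff x) (fun x _ => by rw [← iteratedDeriv_succ]; exact hB x)
      (Set.mem_univ r) (Set.mem_univ (r + h))
    rw [add_sub_cancel_left, Real.norm_eq_abs] at this
    linarith

/-! ### Derivatives along coordinate lines -/

lemma contDiff_partialD {n : ℕ} (i : Fin n) {g : (Fin n → ℝ) → ℂ} (hg : ContDiff ℝ ∞ g) :
    ContDiff ℝ ∞ (partialD i g) :=
  contDiff_const.mul ((hg.fderiv_right (m := ∞) (by simp)).clm_apply contDiff_const)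

lemma contDiff_fallingD {n : ℕ} (i : Fin n) (l : ℕ) {g : (Fin n → ℝ) → ℂ} (hg : ContDiff ℝ ∞ g) :
    ContDiff ℝ ∞ (fallingD i l g) := by
  induction l with
  | zero => exact hg
  | succ l ih => exact (contDiff_partialD i ih).sub (contDiff_const.mul ih)

lemma contDiff_line {n : ℕ} (i : Fin n) {g : (Fin n → ℝ) → ℂ} (hg : ContDiff ℝ ∞ g)
    (t : Fin n → ℝ) : ContDiff ℝ ∞ fun s : ℝ => g (t + s • Pi.single i 1) :=
  hg.comp (contDiff_const.add (contDiff_id.smul contDiff_const))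

lemma deriv_line {n : ℕ} (i : Fin n) {g : (Fin n → ℝ) → ℂ} (hg : ContDiff ℝ ∞ g)
    (t : Fin n → ℝ) :
    deriv (fun s : ℝ => g (t + s • Pi.single i 1)) =
      fun s => (2 * Real.pi * Complex.I) * partialD i g (t + s • Pi.single i 1) := by
  ext s
  have h1 : HasDerivAt (fun s : ℝ => t + s • (Pi.single i 1 : Fin n → ℝ)) (Pi.single i 1) s := by
    simpa using ((hasDerivAt_id s).smul_const (Pi.single i (1 : ℝ) : Fin n → ℝ)).const_add t
  have h2 := ((hg.differentiable (by simp)) (t + s • Pi.single i 1)).hasFDerivAt.comp_hasDerivAt s h1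
  refine h2.deriv.trans ?_
  have : (2 * Real.pi * Complex.I : ℂ) ≠ 0 := Complex.two_pi_I_ne_zero
  simp only [partialD]
  rw [mul_inv_cancel_left₀ this]

/-- Ordinary derivatives are recovered from the falling ones by D D^{(l)} = D^{(l+1)} + l D^{(l)}.
Carrying every starting order `l` in the statement makes the induction on `N` close. -/
lemma exists_bound_iteratedDeriv_line {ι : Type*} {n : ℕ} (i : Fin n) {g : ι → (Fin n → ℝ) → ℂ}
    (hg : ∀ κ, ContDiff ℝ ∞ (g κ)) (W : ι → ℝ)
    (hb : ∀ l, ∃ C, ∀ κ t, ‖fallingD i l (g κ) t‖ ≤ C * W κ) (N l : ℕ) :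
    ∃ B, ∀ κ t s,
      ‖iteratedDeriv N (fun s : ℝ => fallingD i l (g κ) (t + s • Pi.single i 1)) s‖ ≤ B * W κ := by
  induction N generalizing l with
  | zero =>
    obtain ⟨C, hC⟩ := hb l
    exact ⟨C, fun κ t s => by simpa using hC κ _⟩
  | succ N ih =>
    obtain ⟨B₁, h₁⟩ := ih (l + 1)
    obtain ⟨B₂, h₂⟩ := ih l
    set c : ℂ := 2 * Real.pi * Complex.I with hc
    refine ⟨‖c‖ * (B₁ + l * B₂), fun κ t s => ?_⟩
    have hs := fun l => contDiff_line i (contDiff_fallingD i l (hg κ)) t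
    have hcd : ∀ l, ContDiffAt ℝ N
        (fun s : ℝ => fallingD i l (g κ) (t + s • Pi.single i 1)) s := fun l =>
      ((hs l).of_le (by exact_mod_cast le_top)).contDiffAt
    have hd : deriv (fun s : ℝ => fallingD i l (g κ) (t + s • Pi.single i 1)) =
        fun s => c * (fallingD i (l + 1) (g κ) (t + s • Pi.single i 1) +
          l * fallingD i l (g κ) (t + s • Pi.single i 1)) := by
      rw [deriv_line i (contDiff_fallingD i l (hg κ)) t]
      ext s
      simp only [fallingD]
      ring
    rw [iteratedDeriv_succ', hd, iteratedDeriv_const_mul_field, iteratedDeriv_fun_add (hcd _)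
      (contDiffAt_const.mul (hcd _)), iteratedDeriv_const_mul_field]
    rw [norm_mul, mul_assoc]
    gcongr
    refine (norm_add_le _ _).trans ?_
    rw [norm_mul, Complex.norm_natCast, add_mul, mul_assoc]
    have h1 := h₁ κ t s
    have h2 := h₂ κ t s
    gcongr

/-! ### Families of smooth functions on the torus -/

/-- A family of smooth functions on the torus all of whose pure partial derivatives are bounded
uniformly in the family. -/
structure UniformlySmooth {ι : Type*} {n : ℕ} (h : ι → Torus n → ℂ) : Prop where
  smooth : ∀ κ, IsSmoothOnTorus (h κ)
  bounded : ∃ B, ∀ κ x, ‖h κ x‖ ≤ B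
  deriv_bounded : ∀ i N, ∃ B, ∀ κ t s,
    ‖iteratedDeriv N (fun s : ℝ => torusLift (h κ) (t + s • Pi.single i 1)) s‖ ≤ B

lemma isOpenQuotientMap_coe_torus (n : ℕ) :
    IsOpenQuotientMap (fun (t : Fin n → ℝ) (i : Fin n) => (t i : UnitAddCircle)) :=
  IsOpenQuotientMap.piMap fun _ => QuotientAddGroup.isOpenQuotientMap_mk

lemma exists_coe_torus {n : ℕ} (x : Torus n) : ∃ t : Fin n → ℝ, (fun i => (t i : UnitAddCircle)) = x :=
  (isOpenQuotientMap_coe_torus n).surjective x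

lemma IsSmoothOnTorus.continuous {n : ℕ} {f : Torus n → ℂ} (hf : IsSmoothOnTorus f) :
    Continuous f :=
  (isOpenQuotientMap_coe_torus n).isQuotientMap.continuous_iff.mpr (ContDiff.continuous hf)

lemma uniformlySmooth_of_fallingD {ι : Type*} {n : ℕ} {h : ι → Torus n → ℂ}
    (hs : ∀ κ, IsSmoothOnTorus (h κ)) {W : ι → ℝ} (hW : ∀ κ, 0 < W κ)
    (hb0 : ∃ C, ∀ κ t, ‖torusLift (h κ) t‖ ≤ C * W κ)
    (hb : ∀ i l, ∃ C, ∀ κ t, ‖fallingD i l (torusLift (h κ)) t‖ ≤ C * W κ) :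
    UniformlySmooth fun κ x => ((W κ)⁻¹ : ℂ) * h κ x := by
  have hn : ∀ κ, ‖((W κ)⁻¹ : ℂ)‖ = (W κ)⁻¹ := fun κ => by
    rw [norm_inv, Complex.norm_real, Real.norm_of_nonneg (hW κ).le]
  refine ⟨fun κ => contDiff_const.mul (hs κ), ?_, fun i N => ?_⟩
  · obtain ⟨C, hC⟩ := hb0
    refine ⟨C, fun κ x => ?_⟩
    obtain ⟨t, rfl⟩ := exists_coe_torus x
    rw [norm_mul, hn, inv_mul_le_iff₀ (hW κ), mul_comm]
    exact hC κ t
  · obtain ⟨B, hB⟩ := exists_bound_iteratedDeriv_line i hs W (hb i) N 0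
    refine ⟨B, fun κ t s => ?_⟩
    have : (fun s : ℝ => torusLift (fun x => ((W κ)⁻¹ : ℂ) * h κ x) (t + s • Pi.single i 1)) =
      fun s => ((W κ)⁻¹ : ℂ) * torusLift (h κ) (t + s • Pi.single i 1) := rfl
    rw [this, iteratedDeriv_const_mul_field, norm_mul, hn, inv_mul_le_iff₀ (hW κ), mul_comm]
    exact hB κ t s

lemma UniformlySmooth.inv {ι : Type*} {n : ℕ} {h : ι → Torus n → ℂ} (hh : UniformlySmooth h)
    {c : ℝ} (hc : 0 < c) (hhc : ∀ κ x, c ≤ ‖h κ x‖) : UniformlySmooth fun κ x => (h κ x)⁻¹ := by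
  refine ⟨fun κ => ContDiff.inv (hh.smooth κ) fun t ht => ?_, ⟨c⁻¹, fun κ x => ?_⟩, fun i N => ?_⟩
  · have := hhc κ fun i => (t i : UnitAddCircle)
    rw [show h κ (fun i => (t i : UnitAddCircle)) = 0 from ht, norm_zero] at this
    linarith
  · rw [norm_inv]
    exact inv_anti₀ hc (hhc κ x)
  · obtain ⟨B, hB⟩ := exists_bound_iteratedDeriv_inv
      (g := fun (p : ι × (Fin n → ℝ)) s => torusLift (h p.1) (p.2 + s • Pi.single i 1))
      (fun p => contDiff_line i (hh.smooth p.1) p.2)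
      (fun M => by
        obtain ⟨B, hB⟩ := hh.deriv_bounded i M
        exact ⟨B, fun p s => hB p.1 p.2 s⟩) hc (fun p s => hhc _ _) N N le_rfl
    exact ⟨B, fun κ t s => hB (κ, t) s⟩

/-! ### Decay of Fourier coefficients -/

instance isProbabilityMeasure_torusMeasure (n : ℕ) : IsProbabilityMeasure (torusMeasure n) := by
  unfold torusMeasure; infer_instance

instance isAddLeftInvariant_torusMeasure (n : ℕ) : (torusMeasure n).IsAddLeftInvariant := by
  unfold torusMeasure; infer_instance

lemma integrable_torus {n : ℕ} {f : Torus n → ℂ} (hf : Continuous f) :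
    Integrable f (torusMeasure n) :=
  hf.integrable_of_hasCompactSupport (HasCompactSupport.of_compactSpace f)

lemma mFourier_apply_add {n : ℕ} (k : Lattice n) (x v : Torus n) :
    UnitAddTorus.mFourier k (x + v) = UnitAddTorus.mFourier k x * UnitAddTorus.mFourier k v := by
  simp [UnitAddTorus.mFourier, fourier_apply, smul_add, AddCircle.toCircle_add,
    Finset.prod_mul_distrib]

lemma norm_mFourier_apply {n : ℕ} (k : Lattice n) (x : Torus n) :
    ‖UnitAddTorus.mFourier k x‖ = 1 := by
  simp only [UnitAddTorus.mFourier, ContinuousMap.coe_mk, fourier_apply, norm_prod,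
    Circle.norm_coe, Finset.prod_const_one]

lemma mFourier_mul_mFourier_neg {n : ℕ} (k : Lattice n) (x : Torus n) :
    UnitAddTorus.mFourier k x * UnitAddTorus.mFourier (-k) x = 1 := by
  rw [← UnitAddTorus.mFourier_add, add_neg_cancel, UnitAddTorus.mFourier_zero]; rfl

lemma norm_fourierLatticeInv_le {n : ℕ} {h : Torus n → ℂ} {B : ℝ} (hB : ∀ x, ‖h x‖ ≤ B)
    (k : Lattice n) : ‖fourierLatticeInv h k‖ ≤ B := by
  have := norm_integral_le_of_norm_le_const (μ := torusMeasure n) (C := B)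
    (f := fun x => UnitAddTorus.mFourier k x * h x)
    (Filter.Eventually.of_forall fun x => by rw [norm_mul, norm_mFourier_apply, one_mul]; exact hB x)
  simpa [fourierLatticeInv] using this

lemma fourierLatticeInv_translate {n : ℕ} (h : Torus n → ℂ) (v : Torus n) (k : Lattice n) :
    fourierLatticeInv (fun x => h (x + v)) k =
      UnitAddTorus.mFourier (-k) v * fourierLatticeInv h k := by
  unfold fourierLatticeInv
  rw [← integral_add_right_eq_self (fun x => UnitAddTorus.mFourier k x * h x) v,
    ← integral_const_mul]
  refine integral_congr_ae (Filter.Eventually.of_forall fun x => ?_)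
  have := mFourier_mul_mFourier_neg k v
  simp only [mFourier_apply_add]
  linear_combination -(UnitAddTorus.mFourier k x * h (x + v)) * this

lemma fourierLatticeInv_sub {n : ℕ} {f g : Torus n → ℂ} (hf : Continuous f) (hg : Continuous g)
    (k : Lattice n) :
    fourierLatticeInv (fun x => f x - g x) k = fourierLatticeInv f k - fourierLatticeInv g k := by
  unfold fourierLatticeInv
  rw [← integral_sub (integrable_torus (by fun_prop)) (integrable_torus (by fun_prop))]
  simp only [mul_sub]

lemma fourierLatticeInv_const_mul {n : ℕ} (c : ℂ) (f : Torus n → ℂ) (k : Lattice n) :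
    fourierLatticeInv (fun x => c * f x) k = c * fourierLatticeInv f k := by
  unfold fourierLatticeInv
  rw [← integral_const_mul]
  simp only [mul_left_comm]

lemma fourierLatticeInv_fwdDiff_iter {n : ℕ} {h : Torus n → ℂ} (hh : Continuous h) (v : Torus n)
    (N : ℕ) (k : Lattice n) :
    fourierLatticeInv ((fwdDiff v)^[N] h) k =
      (UnitAddTorus.mFourier (-k) v - 1) ^ N * fourierLatticeInv h k := by
  induction N generalizing h with
  | zero => simp
  | succ N ih =>
    have hs : Continuous fun x => h (x + v) := by fun_prop
    rw [Function.iterate_succ_apply, ih (h := fwdDiff v h) (hs.sub hh)]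
    have : fwdDiff v h = fun x => h (x + v) - h x := rfl
    rw [this, fourierLatticeInv_sub hs hh, fourierLatticeInv_translate]
    ring

lemma fwdDiff_iter_line {n : ℕ} (h : Torus n → ℂ) (i : Fin n) (r : ℝ) (N : ℕ) (t : Fin n → ℝ)
    (s : ℝ) :
    (fwdDiff r)^[N] (fun s : ℝ => torusLift h (t + s • Pi.single i 1)) s =
      torusLift ((fwdDiff (Pi.single i (r : UnitAddCircle) : Torus n))^[N] h)
        (t + s • Pi.single i 1) := by
  induction N generalizing h with
  | zero => rfl
  | succ N ih =>
    rw [Function.iterate_succ_apply, Function.iterate_succ_apply, ← ih]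
    refine congrFun (congrArg _ (funext fun s => ?_)) s
    have hadd : (fun j => (((t + (s + r) • (Pi.single i 1 : Fin n → ℝ)) j : ℝ) : UnitAddCircle)) =
        (fun j => (((t + s • (Pi.single i 1 : Fin n → ℝ)) j : ℝ) : UnitAddCircle)) +
          Pi.single i (r : UnitAddCircle) := by
      funext j
      by_cases hj : j = i
      · subst hj; simp [add_assoc]
      · simp [hj]
    simp only [fwdDiff, torusLift, hadd]

/-- Translation by half a period in direction `i` flips the sign of the character. Hence an N-fold
difference with this step multiplies the `k`-th coefficient by (-2)^N. -/
lemma mFourier_single_half {n : ℕ} (k : Lattice n) (i : Fin n) (hi : k i ≠ 0) :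
    UnitAddTorus.mFourier (-k)
      (Pi.single i (((2 * (k i : ℝ))⁻¹ : ℝ) : UnitAddCircle) : Torus n) = -1 := by
  have hi' : (k i : ℂ) ≠ 0 := by exact_mod_cast hi
  simp only [UnitAddTorus.mFourier, ContinuousMap.coe_mk]
  rw [Finset.prod_eq_single i (fun j _ hj => by simp [Pi.single_eq_of_ne hj]) (by simp)]
  rw [Pi.single_eq_same, fourier_coe_apply, ← Complex.exp_neg_pi_mul_I]
  congr 1
  push_cast
  simp
  field_simp

/-- Finite differences play the role of integration by parts. With step r = 1/(2 k_i), the N-th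
difference of `h` is at most |r|^N B in size, while its `k`-th coefficient is (-2)^N times that of
`h`. -/
lemma abs_pow_mul_norm_fourierLatticeInv_le {n : ℕ} {h : Torus n → ℂ} (hs : IsSmoothOnTorus h)
    {i : Fin n} {N : ℕ} {B : ℝ}
    (hB : ∀ t s, ‖iteratedDeriv N (fun s : ℝ => torusLift h (t + s • Pi.single i 1)) s‖ ≤ B)
    {k : Lattice n} (hi : k i ≠ 0) : |(k i : ℝ)| ^ N * ‖fourierLatticeInv h k‖ ≤ B := by
  set r : ℝ := (2 * (k i : ℝ))⁻¹ with hr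
  have hi' : (0 : ℝ) < |(k i : ℝ)| := abs_pos.mpr (by exact_mod_cast hi)
  have h1 := fourierLatticeInv_fwdDiff_iter hs.continuous
    (Pi.single i (r : UnitAddCircle) : Torus n) N k
  rw [mFourier_single_half k i hi] at h1
  have h2 : ∀ x, ‖(fwdDiff (Pi.single i (r : UnitAddCircle) : Torus n))^[N] h x‖ ≤ |r| ^ N * B := by
    intro x
    obtain ⟨t, rfl⟩ := exists_coe_torus x
    have := norm_fwdDiff_iter_le (contDiff_line i hs t) (hB t) r 0
    rw [fwdDiff_iter_line] at this
    simpa [torusLift] using this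
  have h3 := norm_fourierLatticeInv_le h2 k
  rw [h1, norm_mul, norm_pow] at h3
  norm_num at h3
  have hr' : |r| = (2 * |(k i : ℝ)|)⁻¹ := by rw [hr, abs_inv, abs_mul, abs_two]
  rw [hr', inv_pow, ← div_eq_inv_mul, le_div_iff₀ (by positivity), mul_pow] at h3
  -- The argument gives the bound with B/4^N; the gain is discarded.
  have h4 : (1 : ℝ) ≤ 2 ^ N * 2 ^ N := one_le_mul_of_one_le_of_one_le
    (one_le_pow₀ one_le_two) (one_le_pow₀ one_le_two)
  have h5 : 0 ≤ |(k i : ℝ)| ^ N * ‖fourierLatticeInv h k‖ := by positivity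
  nlinarith

/-- Take a coordinate of largest modulus. Because of this choice, pure derivatives in the coordinate
directions suffice for decay in all of `k`. -/
lemma exists_bracket_le {n : ℕ} {k : Lattice n} (hk : k ≠ 0) :
    ∃ i, k i ≠ 0 ∧ bracket k ≤ (n + 1) * |(k i : ℝ)| := by
  obtain ⟨j, hj⟩ := Function.ne_iff.mp hk
  obtain ⟨i, _, hi⟩ := Finset.exists_max_image Finset.univ (fun i => (k i).natAbs)
    ⟨j, Finset.mem_univ j⟩
  have hi0 : k i ≠ 0 := by
    have := hi j (Finset.mem_univ j)
    simp at hj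
    omega
  refine ⟨i, hi0, ?_⟩
  have h1 : latticeSize k ≤ n * (k i).natAbs := by
    simpa [latticeSize] using Finset.sum_le_card_nsmul Finset.univ _ _ hi
  have h2 : 1 + latticeSize k ≤ (n + 1) * (k i).natAbs := by
    have : 1 ≤ (k i).natAbs := by omega
    linarith
  have h3 : ((k i).natAbs : ℝ) = |(k i : ℝ)| := by rw [Nat.cast_natAbs, Int.cast_abs]
  unfold bracket
  rw [← h3]
  exact_mod_cast h2

lemma UniformlySmooth.exists_deriv_bound {ι : Type*} {n : ℕ} {h : ι → Torus n → ℂ}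
    (hh : UniformlySmooth h) (N : ℕ) : ∃ B, 0 < B ∧ ∀ i κ t s,
      ‖iteratedDeriv N (fun s : ℝ => torusLift (h κ) (t + s • Pi.single i 1)) s‖ ≤ B := by
  refine exists_uniform_bound _ (fun i C C' hC hP κ t s => (hP κ t s).trans hC) fun i => ?_
  obtain ⟨B, hB⟩ := hh.deriv_bounded i N
  exact ⟨|B| + 1, by positivity, fun κ t s => (hB κ t s).trans (by linarith [le_abs_self B])⟩

lemma UniformlySmooth.exists_bracket_pow_mul_norm_le {ι : Type*} {n : ℕ} {h : ι → Torus n → ℂ}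
    (hh : UniformlySmooth h) (N : ℕ) :
    ∃ B, 0 < B ∧ ∀ κ k, bracket k ^ N * ‖fourierLatticeInv (h κ) k‖ ≤ B := by
  obtain ⟨B₀, h₀⟩ := hh.bounded
  obtain ⟨B₁, hB₁, h₁⟩ := hh.exists_deriv_bound N
  refine ⟨|B₀| + (n + 1) ^ N * B₁, by positivity, fun κ k => ?_⟩
  have hB₁' : 0 < (n + 1 : ℝ) ^ N * B₁ := by positivity
  by_cases hk : k = 0
  · have := norm_fourierLatticeInv_le (h₀ κ) k
    have h0 : bracket k = 1 := by simp [hk, bracket, latticeSize]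
    rw [h0, one_pow, one_mul]
    linarith [le_abs_self B₀]
  · obtain ⟨i, hi, hb⟩ := exists_bracket_le hk
    have h2 := abs_pow_mul_norm_fourierLatticeInv_le (hh.smooth κ) (h₁ i κ) hi
    calc bracket k ^ N * ‖fourierLatticeInv (h κ) k‖
        ≤ ((n + 1) * |(k i : ℝ)|) ^ N * ‖fourierLatticeInv (h κ) k‖ := by
          have := bracket_pos k
          gcongr
      _ = (n + 1) ^ N * (|(k i : ℝ)| ^ N * ‖fourierLatticeInv (h κ) k‖) := by rw [mul_pow]; ring
      _ ≤ (n + 1) ^ N * B₁ := by gcongr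
      _ ≤ _ := by linarith [abs_nonneg B₀]

/-! ### Fourier series on the torus -/

lemma summable_mFourier_mul {n : ℕ} {c : Lattice n → ℂ} (hc : Summable fun k => ‖c k‖)
    (x : Torus n) : Summable fun q => UnitAddTorus.mFourier (-q) x * c q :=
  .of_norm (by simpa [norm_mFourier_apply] using hc)

lemma continuous_fourierLattice {n : ℕ} {c : Lattice n → ℂ} (hc : Summable fun k => ‖c k‖) :
    Continuous (fourierLattice c) :=
  continuous_tsum (fun q => by fun_prop) hc fun q x => by simp [norm_mFourier_apply]

lemma integral_mul_fourierLattice {n : ℕ} {h : Torus n → ℂ} (hh : Continuous h)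
    {c : Lattice n → ℂ} (hc : Summable fun k => ‖c k‖) :
    ∫ x, h x * fourierLattice c x ∂torusMeasure n = ∑' q, fourierLatticeInv h (-q) * c q := by
  have hint : ∀ q, Integrable (fun x => h x * (UnitAddTorus.mFourier (-q) x * c q))
      (torusMeasure n) := fun q => integrable_torus (by fun_prop)
  have hsum : Summable fun q =>
      ∫ x, ‖h x * (UnitAddTorus.mFourier (-q) x * c q)‖ ∂torusMeasure n := by
    simp only [norm_mul, norm_mFourier_apply, one_mul, integral_mul_const]
    exact hc.mul_left _
  have := hasSum_integral_of_summable_integral_norm hint hsum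
  have h1 : ∀ x, ∑' q, h x * (UnitAddTorus.mFourier (-q) x * c q) = h x * fourierLattice c x :=
    fun x => (summable_mFourier_mul hc x).tsum_mul_left _
  simp only [h1] at this
  rw [← this.tsum_eq]
  refine tsum_congr fun q => ?_
  unfold fourierLatticeInv
  rw [← integral_mul_const]
  congr 1
  ext x
  ring

lemma fourierLatticeInv_mFourier_mul {n : ℕ} (h : Torus n → ℂ) (k j : Lattice n) :
    fourierLatticeInv (fun x => UnitAddTorus.mFourier k x * h x) j = fourierLatticeInv h (j + k) := by
  unfold fourierLatticeInv
  simp only [UnitAddTorus.mFourier_add, mul_assoc]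

/-- For `k ≠ 0`, translation by half a period preserves the integral and changes its sign. -/
lemma fourierLatticeInv_one {n : ℕ} (k : Lattice n) :
    fourierLatticeInv (fun _ : Torus n => (1 : ℂ)) k = if k = 0 then 1 else 0 := by
  split_ifs with hk
  · simp [hk, fourierLatticeInv, UnitAddTorus.mFourier_zero]
  · obtain ⟨i, hi⟩ := Function.ne_iff.mp hk
    have h := fourierLatticeInv_translate (fun _ : Torus n => (1 : ℂ))
      (Pi.single i (((2 * (k i : ℝ))⁻¹ : ℝ) : UnitAddCircle) : Torus n) k
    rw [mFourier_single_half k i hi] at h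
    linear_combination h / 2

lemma fourierLatticeInv_mFourier {n : ℕ} (k l : Lattice n) :
    fourierLatticeInv (UnitAddTorus.mFourier k) (-l) = if l = k then 1 else 0 := by
  have := fourierLatticeInv_mFourier_mul (fun _ => 1) k (-l)
  simp only [mul_one] at this
  rw [show (UnitAddTorus.mFourier k : Torus n → ℂ) = fun x => UnitAddTorus.mFourier k x from rfl, this,
    fourierLatticeInv_one]
  simp only [neg_add_eq_zero]

/-- Fourier inversion on the lattice. -/
lemma fourierLatticeInv_fourierLattice {n : ℕ} {c : Lattice n → ℂ} (hc : Summable fun k => ‖c k‖)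
    (k : Lattice n) : fourierLatticeInv (fourierLattice c) k = c k := by
  have := integral_mul_fourierLattice (UnitAddTorus.mFourier k).continuous hc
  simp only [fourierLatticeInv_mFourier] at this
  simpa [fourierLatticeInv] using this

/-- Fourier inversion on the torus. -/
lemma fourierLattice_fourierLatticeInv {n : ℕ} {h : Torus n → ℂ} (hh : Continuous h)
    (hs : Summable fun k => ‖fourierLatticeInv h k‖) :
    fourierLattice (fourierLatticeInv h) = h := by
  ext x
  have hcoeff : ∀ k, UnitAddTorus.mFourierCoeff (⟨h, hh⟩ : C(Torus n, ℂ)) k =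
      fourierLatticeInv h (-k) := fun k => rfl
  have h1 : Summable (UnitAddTorus.mFourierCoeff (⟨h, hh⟩ : C(Torus n, ℂ))) := by
    have := (Equiv.neg (Lattice n)).summable_iff.mpr hs.of_norm
    exact this.congr fun k => (hcoeff k).symm
  have h2 := UnitAddTorus.hasSum_mFourier_series_apply_of_summable h1 x
  rw [← (Equiv.neg (Lattice n)).hasSum_iff] at h2
  refine Eq.trans (tsum_congr fun k => ?_) h2.tsum_eq
  simp only [Function.comp_apply, Equiv.neg_apply, hcoeff, neg_neg, smul_eq_mul]
  ring

lemma integral_mFourier_mul_fourierLattice {n : ℕ} {h : Torus n → ℂ} (hh : Continuous h)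
    {f : Lattice n → ℂ} (hf : Summable fun k => ‖f k‖) (p : Lattice n) :
    ∫ x, UnitAddTorus.mFourier p x * h x * fourierLattice f x ∂torusMeasure n =
      ∑' i, fourierLatticeInv h i * f (p - i) := by
  rw [integral_mul_fourierLattice (by fun_prop) hf, ← (Equiv.subLeft p).tsum_eq]
  refine tsum_congr fun i => ?_
  rw [fourierLatticeInv_mFourier_mul]
  simp

/-! ### Pseudo-differential operators as convolutions with variable coefficients. -/

/-- The convolution form of a pseudo-differential operator on the lattice. -/
def latticeOp {n : ℕ} (σ : Symbol n) (f : Lattice n → ℂ) (k : Lattice n) : ℂ :=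
  ∑' i, fourierLatticeInv (σ k) i * f (k - i)

lemma pseudoDiff_eq_latticeOp {n : ℕ} {σ : Symbol n} (hσ : ∀ k, Continuous (σ k))
    {f : Lattice n → ℂ} (hf : Summable fun k => ‖f k‖) : pseudoDiff σ f = latticeOp σ f := by
  ext k
  exact integral_mFourier_mul_fourierLattice (hσ k) hf k

/-- Division by a nowhere vanishing symbol with frozen coefficients. -/
lemma eq_tsum_fourierLatticeInv_inv {n : ℕ} {h : Torus n → ℂ} (hh : Continuous h)
    (hne : ∀ x, h x ≠ 0) (hs : Summable fun k => ‖fourierLatticeInv (fun x => (h x)⁻¹) k‖)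
    {f : Lattice n → ℂ} (hf : Summable fun k => ‖f k‖) (k : Lattice n) :
    f k = ∑' j, fourierLatticeInv (fun x => (h x)⁻¹) j *
      ∑' i, fourierLatticeInv h i * f (k - j - i) := by
  have hinv : Continuous fun x => (h x)⁻¹ := hh.inv₀ hne
  have hfc := continuous_fourierLattice hf
  -- Expand the factor 1/h in its Fourier series and pair it with e_k h f̂. The product is e_k f̂,
  -- whose integral is f(k).
  have h1 := integral_mul_fourierLattice
    (h := fun x => UnitAddTorus.mFourier k x * (h x * fourierLattice f x)) (by fun_prop) hs
  rw [fourierLattice_fourierLatticeInv hinv hs] at h1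
  have h2 : ∀ x, UnitAddTorus.mFourier k x * (h x * fourierLattice f x) * (h x)⁻¹ =
      UnitAddTorus.mFourier k x * fourierLattice f x := fun x => by
    have := hne x
    field_simp
  simp only [h2, fourierLatticeInv_mFourier_mul] at h1
  rw [← fourierLatticeInv_fourierLattice hf k, fourierLatticeInv, h1]
  refine tsum_congr fun j => ?_
  rw [mul_comm, ← integral_mFourier_mul_fourierLattice hh hf]
  congr 1
  rw [fourierLatticeInv, neg_add_eq_sub]
  simp only [mul_assoc]

/-- The coefficients of a character form a delta, so only the term l = k of the pairing survives. -/
lemma weightPowD_apply {n : ℕ} (Λ : Lattice n → ℝ) (s : ℝ) (w : Lattice n → ℂ) (k : Lattice n) :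
    weightPowD Λ s w k = (Λ k ^ s : ℝ) * w k := by
  unfold weightPowD pseudoDiffDistribution fourierDistribution
  rw [tsum_eq_single k]
  · simp only [mul_comm _ ((Λ k ^ s : ℝ) : ℂ), fourierLatticeInv_const_mul]
    have := fourierLatticeInv_mFourier k k
    rw [if_pos rfl] at this
    rw [show fourierLatticeInv (fun x => UnitAddTorus.mFourier k x) (-k) = 1 from this]
    ring
  · intro l hl
    simp only [mul_comm _ ((Λ k ^ s : ℝ) : ℂ), fourierLatticeInv_const_mul]
    have := fourierLatticeInv_mFourier k l
    rw [if_neg hl] at this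
    rw [show fourierLatticeInv (fun x => UnitAddTorus.mFourier k x) (-l) = 0 from this]
    ring

/-! ### Summability over the lattice -/

lemma summable_prod_inv_sq (n : ℕ) :
    Summable fun k : Lattice n => ∏ i, ((1 + |(k i : ℝ)|) ^ 2)⁻¹ := by
  induction n with
  | zero => exact Summable.of_finite
  | succ n ih =>
    have h1 : Summable fun a : ℤ => ((1 + |(a : ℝ)|) ^ 2)⁻¹ := by
      refine Summable.of_norm_bounded_eventually
        (g := fun a : ℤ => 1 / (a : ℝ) ^ 2) (Real.summable_one_div_int_pow.mpr one_lt_two) ?_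
      filter_upwards [(Set.finite_singleton (0 : ℤ)).compl_mem_cofinite] with a ha
      have ha0 : (a : ℝ) ≠ 0 := by exact_mod_cast ha
      have : 0 < (a : ℝ) ^ 2 := by positivity
      rw [Real.norm_of_nonneg (by positivity), one_div]
      apply inv_anti₀ this
      rw [← sq_abs (a : ℝ)]
      gcongr
      linarith
    have h2 := h1.mul_of_nonneg ih (fun a => by positivity) (fun k => by positivity)
    rw [← (Fin.consEquiv fun _ : Fin (n + 1) => ℤ).summable_iff]
    refine h2.congr fun p => ?_
    simp [Fin.prod_univ_succ, Fin.consEquiv, mul_comm]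

/-- The bracket dominates each 1 + |k_i|, so its power 2n dominates the product of the squares. This
is why 2n is the reserve of decay kept in all kernel estimates. -/
lemma summable_bracket_pow_inv (n : ℕ) : Summable fun k : Lattice n => (bracket k ^ (2 * n))⁻¹ := by
  refine Summable.of_nonneg_of_le (fun k => by have := bracket_pos k; positivity) (fun k => ?_)
    (summable_prod_inv_sq n)
  rw [Finset.prod_inv_distrib]
  apply inv_anti₀ (Finset.prod_pos fun i _ => by positivity)
  calc ∏ i, (1 + |(k i : ℝ)|) ^ 2 ≤ ∏ _i : Fin n, bracket k ^ 2 := by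
        refine Finset.prod_le_prod (fun i _ => by positivity) fun i _ => ?_
        have h3 : ((k i).natAbs : ℝ) = |(k i : ℝ)| := by rw [Nat.cast_natAbs, Int.cast_abs]
        have : (k i).natAbs ≤ latticeSize k :=
          Finset.single_le_sum (f := fun i => (k i).natAbs) (fun _ _ => Nat.zero_le _)
            (Finset.mem_univ i)
        rw [← h3, bracket]
        gcongr
    _ = bracket k ^ (2 * n) := by simp [← pow_mul]

lemma bracket_le_one_add_euclNorm {n : ℕ} (k : Lattice n) :
    bracket k ≤ (n + 1) * (1 + euclNorm k) := by
  have h1 : ∀ i, ((k i).natAbs : ℝ) ≤ euclNorm k := fun i => by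
    rw [Nat.cast_natAbs, Int.cast_abs]
    refine Real.abs_le_sqrt ?_
    exact Finset.single_le_sum (f := fun i => (k i : ℝ) ^ 2) (fun _ _ => sq_nonneg _)
      (Finset.mem_univ i)
  have h2 : (latticeSize k : ℝ) ≤ n * euclNorm k := by
    unfold latticeSize
    push_cast
    simpa using Finset.sum_le_card_nsmul Finset.univ _ _ fun i _ => h1 i
  have h3 : 0 ≤ euclNorm k := Real.sqrt_nonneg _
  have h4 : (0 : ℝ) ≤ n := by positivity
  unfold bracket
  nlinarith

lemma IsSchwartz.exists_bracket_bound {n : ℕ} {f : Lattice n → ℂ} (hf : IsSchwartz f) (N : ℕ) :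
    ∃ C, ∀ k, ‖f k‖ ≤ C * (bracket k ^ N)⁻¹ := by
  obtain ⟨C, hC⟩ := hf N
  refine ⟨(n + 1) ^ N * C, fun k => ?_⟩
  have hb := bracket_pos k
  rw [← div_eq_mul_inv, le_div_iff₀ (by positivity)]
  calc ‖f k‖ * bracket k ^ N ≤ ‖f k‖ * ((n + 1) * (1 + euclNorm k)) ^ N := by
        gcongr; exact bracket_le_one_add_euclNorm k
    _ = (n + 1) ^ N * ((1 + euclNorm k) ^ N * ‖f k‖) := by rw [mul_pow]; ring
    _ ≤ _ := by gcongr; exact hC k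

lemma IsSchwartz.summable_norm {n : ℕ} {f : Lattice n → ℂ} (hf : IsSchwartz f) :
    Summable fun k => ‖f k‖ := by
  obtain ⟨C, hC⟩ := hf.exists_bracket_bound (2 * n)
  exact Summable.of_nonneg_of_le (fun _ => norm_nonneg _) hC
    ((summable_bracket_pow_inv n).mul_left C)

/-! ### Square sums of extended nonnegative functions -/

/-- The sum of the squares of an extended nonnegative function on the lattice. -/
def sqSum {n : ℕ} (g : Lattice n → ENNReal) : ENNReal := ∑' k, g k ^ 2

lemma ENNReal_two_mul_le_add_sq (a b : ENNReal) : 2 * (a * b) ≤ a ^ 2 + b ^ 2 := by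
  wlog h : a ≤ b generalizing a b
  · rw [mul_comm a b, add_comm]
    exact this b a (le_of_not_ge h)
  · obtain ⟨c, rfl⟩ := exists_add_of_le h
    calc 2 * (a * (a + c)) ≤ 2 * (a * (a + c)) + c ^ 2 := le_self_add
      _ = _ := by ring

lemma ENNReal_add_sq_le (a b : ENNReal) : (a + b) ^ 2 ≤ 2 * a ^ 2 + 2 * b ^ 2 := by
  calc (a + b) ^ 2 = a ^ 2 + b ^ 2 + 2 * (a * b) := by ring
    _ ≤ a ^ 2 + b ^ 2 + (a ^ 2 + b ^ 2) := by gcongr; exact ENNReal_two_mul_le_add_sq a b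
    _ = _ := by ring

/-- The Cauchy–Schwarz inequality for the measure with weights `w`: expand the square as a double
sum and apply 2ab ≤ a² + b² to each term. -/
lemma ENNReal_sq_tsum_mul_le {ι : Type*} (w g : ι → ENNReal) :
    (∑' j, w j * g j) ^ 2 ≤ (∑' j, w j) * ∑' j, w j * g j ^ 2 := by
  have h1 : 2 * (∑' j, w j * g j) ^ 2 ≤ 2 * ((∑' j, w j) * ∑' j, w j * g j ^ 2) := by
    calc 2 * (∑' j, w j * g j) ^ 2 = ∑' j, ∑' l, w j * w l * (2 * (g j * g l)) := by
          rw [sq, ← ENNReal.tsum_mul_right, ← ENNReal.tsum_mul_left]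
          refine tsum_congr fun j => ?_
          rw [← ENNReal.tsum_mul_left, ← ENNReal.tsum_mul_left]
          refine tsum_congr fun l => ?_
          ring
      _ ≤ ∑' j, ∑' l, (w l * (w j * g j ^ 2) + w j * (w l * g l ^ 2)) := by
          refine ENNReal.tsum_le_tsum fun j => ENNReal.tsum_le_tsum fun l => ?_
          calc _ ≤ w j * w l * (g j ^ 2 + g l ^ 2) := by
                gcongr; exact ENNReal_two_mul_le_add_sq _ _
            _ = _ := by ring
      _ = _ := by
          simp only [ENNReal.tsum_add, ENNReal.tsum_mul_left, ENNReal.tsum_mul_right]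
          ring
  exact (ENNReal.mul_le_mul_iff_right two_ne_zero ENNReal.ofNat_ne_top).mp h1

lemma sqSum_mono {n : ℕ} {g h : Lattice n → ENNReal} (H : ∀ k, g k ≤ h k) : sqSum g ≤ sqSum h :=
  ENNReal.tsum_le_tsum fun k => by gcongr; exact H k

lemma sqSum_const_mul {n : ℕ} (c : ENNReal) (g : Lattice n → ENNReal) :
    sqSum (fun k => c * g k) = c ^ 2 * sqSum g := by
  simp only [sqSum, mul_pow, ENNReal.tsum_mul_left]

lemma sqSum_add_le {n : ℕ} (g h : Lattice n → ENNReal) :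
    sqSum (fun k => g k + h k) ≤ 2 * sqSum g + 2 * sqSum h := by
  unfold sqSum
  rw [← ENNReal.tsum_mul_left, ← ENNReal.tsum_mul_left, ← ENNReal.tsum_add]
  exact ENNReal.tsum_le_tsum fun k => ENNReal_add_sq_le _ _

/-- Young's inequality `ℓ¹ * ℓ² ⊆ ℓ²`. -/
lemma sqSum_conv_le {n : ℕ} (w g : Lattice n → ENNReal) :
    sqSum (fun k => ∑' j, w j * g (k - j)) ≤ (∑' j, w j) ^ 2 * sqSum g := by
  unfold sqSum
  calc _ ≤ ∑' k, (∑' j, w j) * ∑' j, w j * g (k - j) ^ 2 :=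
        ENNReal.tsum_le_tsum fun k => ENNReal_sq_tsum_mul_le _ _
    _ = (∑' j, w j) * ∑' j, w j * ∑' k, g (k - j) ^ 2 := by
        rw [ENNReal.tsum_mul_left, ENNReal.tsum_comm]
        simp only [ENNReal.tsum_mul_left]
    _ = (∑' j, w j) * ∑' j, w j * ∑' k, g k ^ 2 := by
        congr 2
        ext j
        exact congrArg (w j * ·) ((Equiv.subRight j).tsum_eq fun k => g k ^ 2)
    _ = _ := by rw [ENNReal.tsum_mul_right]; ring

lemma enorm_tsum_le {ι : Type*} (f : ι → ℂ) : ‖∑' i, f i‖ₑ ≤ ∑' i, ‖f i‖ₑ := by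
  by_cases h : Summable fun i => ‖f i‖
  · rw [← ofReal_norm]
    simp only [← ofReal_norm (f _)]
    rw [← ENNReal.ofReal_tsum_of_nonneg (fun _ => norm_nonneg _) h]
    exact ENNReal.ofReal_le_ofReal (norm_tsum_le_tsum_norm h)
  · rw [tsum_eq_zero_of_not_summable fun h' => h h'.norm]
    simp

/-- A summable weight on the lattice. -/
def decayWeight {n : ℕ} (k : Lattice n) : ENNReal := ENNReal.ofReal (bracket k ^ (2 * n))⁻¹

lemma tsum_decayWeight_ne_top (n : ℕ) : ∑' k : Lattice n, decayWeight k ≠ ⊤ := by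
  unfold decayWeight
  rw [← ENNReal.ofReal_tsum_of_nonneg (fun k => by have := bracket_pos k; positivity)
    (summable_bracket_pow_inv n)]
  exact ENNReal.ofReal_ne_top

/-! ### Square summable sequences -/

lemma memℓp_two_iff {n : ℕ} {f : Lattice n → ℂ} : Memℓp f 2 ↔ sqSum (fun k => ‖f k‖ₑ) ≠ ⊤ := by
  rw [memℓp_gen_iff (by norm_num)]
  have : ∀ k, ‖f k‖ₑ ^ 2 = ENNReal.ofReal (‖f k‖ ^ 2) := fun k => by
    rw [ENNReal.ofReal_pow (norm_nonneg _), ofReal_norm]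
  simp only [sqSum, this, ENNReal.toReal_ofNat, Real.rpow_two]
  refine ⟨fun h => h.tsum_ofReal_ne_top, fun h => ?_⟩
  have := ENNReal.summable_toReal h
  simpa [ENNReal.toReal_ofReal] using this

lemma sqSum_enorm_ellTwo {n : ℕ} (u : ellTwo n) :
    sqSum (fun k => ‖u k‖ₑ) = ENNReal.ofReal (‖u‖ ^ 2) := by
  have h := lp.hasSum_norm (p := 2) (by norm_num) u
  simp only [ENNReal.toReal_ofNat, Real.rpow_two] at h
  rw [← h.tsum_eq, ENNReal.ofReal_tsum_of_nonneg (fun k => by positivity) h.summable]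
  refine tsum_congr fun k => ?_
  rw [ENNReal.ofReal_pow (norm_nonneg _), ofReal_norm]

/-! ### Kernel bounds for symbols -/

/-- The case γ = 0 of the definition; the `ℓ²` estimates below are derived from the `S`-bounds. -/
lemma symbolM_subset_symbolS {n : ℕ} {m ρ : ℝ} {Λ : Lattice n → ℝ} :
    symbolM m ρ Λ ⊆ symbolS m ρ Λ := by
  intro σ hσ
  simpa [monomial_zero, multiDiff_zero] using hσ.2 0 (by simp)

lemma uniformlySmooth_of_multiD {n : ℕ} {h : Lattice n → Torus n → ℂ}
    (hs : ∀ k, IsSmoothOnTorus (h k)) {W : Lattice n → ℝ} (hW : ∀ k, 0 < W k)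
    (hb : ∀ β : Fin n → ℕ, ∃ C, 0 < C ∧ ∀ k t, ‖multiD β (torusLift (h k)) t‖ ≤ C * W k) :
    UniformlySmooth fun k x => ((W k)⁻¹ : ℂ) * h k x := by
  refine uniformlySmooth_of_fallingD hs hW ?_ fun i l => ?_
  · obtain ⟨C, _, hC⟩ := hb 0
    refine ⟨C, fun k t => ?_⟩
    have := hC k t
    rwa [multiD, multiComp_zero _ fun j => rfl] at this
  · obtain ⟨C, _, hC⟩ := hb (Pi.single i l)
    refine ⟨C, fun k t => ?_⟩
    simpa only [multiD_single] using hC k t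

lemma UniformlySmooth.exists_coeff_le {n : ℕ} {h : Lattice n → Torus n → ℂ} {W : Lattice n → ℝ}
    (hW : ∀ k, 0 < W k) (hh : UniformlySmooth fun k x => ((W k)⁻¹ : ℂ) * h k x) (N : ℕ) :
    ∃ C, 0 < C ∧ ∀ k i, ‖fourierLatticeInv (h k) i‖ ≤ C * (bracket i ^ N)⁻¹ * W k := by
  obtain ⟨B, hB, hb⟩ := hh.exists_bracket_pow_mul_norm_le N
  refine ⟨B, hB, fun k i => ?_⟩
  have h1 := hb k i
  have hbr := bracket_pos i
  rw [fourierLatticeInv_const_mul, norm_mul, norm_inv, Complex.norm_real,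
    Real.norm_of_nonneg (hW k).le, mul_left_comm, inv_mul_le_iff₀ (hW k)] at h1
  rw [← div_eq_mul_inv, div_mul_eq_mul_div, le_div_iff₀ (by positivity)]
  linarith

section Kernel

variable {n : ℕ} {μ m ρ : ℝ} {Λ : Lattice n → ℝ} {σ : Symbol n}

lemma symbolS_continuous (hσ : σ ∈ symbolS m ρ Λ) (k : Lattice n) : Continuous (σ k) :=
  (hσ.1 k).continuous

lemma symbolS_uniformlySmooth (hΛ : IsWeight μ Λ) (hσ : σ ∈ symbolS m ρ Λ) :
    UniformlySmooth fun k x => ((Λ k ^ m : ℝ) : ℂ)⁻¹ * σ k x := by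
  refine uniformlySmooth_of_multiD hσ.1 (fun k => Real.rpow_pos_of_pos (hΛ.pos k) m) fun β => ?_
  obtain ⟨C, hC, h⟩ := hσ.2 0 β
  exact ⟨C, hC, fun k t => by simpa [multiDiff_zero, multiLength_zero] using h k t⟩

lemma exists_coeff_le (hΛ : IsWeight μ Λ) (hσ : σ ∈ symbolS m ρ Λ) (N : ℕ) :
    ∃ C, 0 < C ∧ ∀ k i, ‖fourierLatticeInv (σ k) i‖ ≤ C * (bracket i ^ N)⁻¹ * Λ k ^ m :=
  (symbolS_uniformlySmooth hΛ hσ).exists_coeff_le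
    (fun k => Real.rpow_pos_of_pos (hΛ.pos k) m) N

lemma exists_coeff_step_le (hΛ : IsWeight μ Λ) (hσ : σ ∈ symbolS m ρ Λ) (N : ℕ) :
    ∃ C, 0 < C ∧ ∀ l k i,
      ‖fourierLatticeInv (σ (k + Pi.single l 1)) i - fourierLatticeInv (σ k) i‖ ≤
        C * (bracket i ^ N)⁻¹ * Λ k ^ (m - ρ) := by
  refine exists_uniform_bound _ (fun l C C' hC hP k i => (hP k i).trans ?_) fun l => ?_
  · have := bracket_pos i
    have := hΛ.pos k
    gcongr
  · have hpos : ∀ k, 0 < Λ k ^ (m - ρ) := fun k => Real.rpow_pos_of_pos (hΛ.pos k) _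
    have hu : UniformlySmooth fun k x => ((Λ k ^ (m - ρ) : ℝ) : ℂ)⁻¹ * diffOp l σ k x := by
      refine uniformlySmooth_of_multiD (fun k => ?_) hpos fun β => ?_
      · exact ContDiff.sub (hσ.1 (k + Pi.single l 1)) (hσ.1 k)
      · obtain ⟨C, hC, h⟩ := hσ.2 (Pi.single l 1) β
        exact ⟨C, hC, fun k t => by simpa [multiDiff_single, multiLength_single] using h k t⟩
    obtain ⟨C, hC, h⟩ := hu.exists_coeff_le hpos N
    refine ⟨C, hC, fun k i => ?_⟩
    rw [← fourierLatticeInv_sub (symbolS_continuous hσ _) (symbolS_continuous hσ _)]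
    exact h k i

/-- Telescope from `k` to `k - j`: each unit step costs Λ^{m-ρ} at an intermediate point, which
Peetre's inequality moves to `k`. The exponent is `Q` from Peetre plus one for the number of steps.
-/
lemma exists_coeff_sub_le (hΛ : IsWeight μ Λ) (hσ : σ ∈ symbolS m ρ Λ) :
    ∃ Q : ℕ, ∀ N : ℕ, ∃ C, 0 < C ∧ ∀ k j i,
      ‖fourierLatticeInv (σ (k - j)) i - fourierLatticeInv (σ k) i‖ ≤
        C * bracket j ^ Q * (bracket i ^ N)⁻¹ * Λ k ^ (m - ρ) := by
  obtain ⟨C₁, hC₁, Q, hQ⟩ := hΛ.exists_rpow_add_le (m - ρ)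
  refine ⟨Q + 1, fun N => ?_⟩
  obtain ⟨C₂, hC₂, h⟩ := exists_coeff_step_le hΛ hσ N
  refine ⟨C₂ * C₁, by positivity, fun k j i => ?_⟩
  have hi := bracket_pos i
  have hj := bracket_pos j
  have hk := hΛ.pos k
  have hstep := norm_sub_le_of_step (fun k => fourierLatticeInv (σ k) i)
    (W := C₂ * (bracket i ^ N)⁻¹ * (C₁ * bracket j ^ Q * Λ k ^ (m - ρ))) (latticeSize j) k
    (fun j' hj' l => (h l _ i).trans (by
      have hj0 := bracket_pos j'
      have : bracket j' ≤ bracket j := by unfold bracket; gcongr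
      gcongr
      exact (hQ k j').trans (by gcongr))) (-j) (latticeSize_neg j).le
  rw [latticeSize_neg, ← sub_eq_add_neg] at hstep
  calc _ ≤ _ := hstep
    _ ≤ bracket j * (C₂ * (bracket i ^ N)⁻¹ * (C₁ * bracket j ^ Q * Λ k ^ (m - ρ))) := by
      gcongr; exact latticeSize_le_bracket j
    _ = _ := by ring

lemma exists_inv_coeff_le (hΛ : IsWeight μ Λ) (hσ : σ ∈ symbolS m ρ Λ) {c R : ℝ} (hc : 0 < c)
    (hell : ∀ k x, R ≤ euclNorm k → c * Λ k ^ m ≤ ‖σ k x‖) (N : ℕ) :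
    ∃ C, 0 < C ∧ ∀ k, R ≤ euclNorm k → ∀ j,
      Λ k ^ m * ‖fourierLatticeInv (fun x => (σ k x)⁻¹) j‖ ≤ C * (bracket j ^ N)⁻¹ := by
  have hu := symbolS_uniformlySmooth hΛ hσ
  have hpos : ∀ k, 0 < Λ k ^ m := fun k => Real.rpow_pos_of_pos (hΛ.pos k) _
  -- The lower bound on |σ| holds only for |k| ≥ R, so the family is restricted to such `k` before
  -- inversion.
  have hu' : UniformlySmooth fun (κ : {k : Lattice n // R ≤ euclNorm k}) x =>
      ((Λ κ ^ m : ℝ) : ℂ)⁻¹ * σ κ x := by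
    refine ⟨fun κ => hu.smooth κ, ?_, fun i N => ?_⟩
    · obtain ⟨B, hB⟩ := hu.bounded
      exact ⟨B, fun κ => hB κ⟩
    · obtain ⟨B, hB⟩ := hu.deriv_bounded i N
      exact ⟨B, fun κ => hB κ⟩
  have hinv := hu'.inv hc fun κ x => by
    rw [norm_mul, norm_inv, Complex.norm_real, Real.norm_of_nonneg (hpos _).le,
      ← div_eq_inv_mul, le_div_iff₀ (hpos _)]
    exact hell κ x κ.2
  obtain ⟨B, hB, hb⟩ := hinv.exists_bracket_pow_mul_norm_le N
  refine ⟨B, hB, fun k hk j => ?_⟩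
  have h1 := hb ⟨k, hk⟩ j
  simp only [mul_inv, inv_inv, fourierLatticeInv_const_mul] at h1
  rw [norm_mul, Complex.norm_real, Real.norm_of_nonneg (hpos k).le] at h1
  have := bracket_pos j
  rw [← div_eq_mul_inv, le_div_iff₀ (by positivity)]
  linarith

lemma summable_of_bracket_bound {a : Lattice n → ℂ} {C : ℝ}
    (h : ∀ i, ‖a i‖ ≤ C * (bracket i ^ (2 * n))⁻¹) : Summable fun i => ‖a i‖ :=
  Summable.of_nonneg_of_le (fun _ => norm_nonneg _) h ((summable_bracket_pow_inv n).mul_left C)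

lemma summable_coeff (hΛ : IsWeight μ Λ) (hσ : σ ∈ symbolS m ρ Λ) (k : Lattice n) :
    Summable fun i => ‖fourierLatticeInv (σ k) i‖ := by
  obtain ⟨C, _, h⟩ := exists_coeff_le hΛ hσ (2 * n)
  refine summable_of_bracket_bound (C := C * Λ k ^ m) fun i => (h k i).trans (le_of_eq ?_)
  ring

lemma summable_mul_of_bounded {a f : Lattice n → ℂ} (ha : Summable fun i => ‖a i‖) {B : ℝ}
    (hf : ∀ i, ‖f i‖ ≤ B) (g : Lattice n → Lattice n) : Summable fun i => a i * f (g i) := by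
  refine .of_norm (Summable.of_nonneg_of_le (fun _ => norm_nonneg _) (fun i => ?_) (ha.mul_right B))
  rw [norm_mul]
  gcongr
  exact hf _

/-- The modulus of `f` with weight `Λ^s`. -/
def weightedNorm (Λ : Lattice n → ℝ) (s : ℝ) (f : Lattice n → ℂ) (k : Lattice n) : ENNReal :=
  ENNReal.ofReal (Λ k ^ s * ‖f k‖)

/-- `T_σ` is bounded from the weighted Sobolev space of order `m` to `ℓ²`. -/
lemma exists_sqSum_latticeOp_le (hΛ : IsWeight μ Λ) (hσ : σ ∈ symbolS m ρ Λ) :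
    ∃ C : ENNReal, C ≠ ⊤ ∧ ∀ f,
      sqSum (fun k => ‖latticeOp σ f k‖ₑ) ≤ C * sqSum (weightedNorm Λ m f) := by
  obtain ⟨C₁, hC₁, Q, hQ⟩ := hΛ.exists_rpow_add_le m
  -- `Q` powers pay for moving Λ^m from `k` to `k - i`; the other 2n leave a summable kernel.
  obtain ⟨C₂, hC₂, h⟩ := exists_coeff_le hΛ hσ (Q + 2 * n)
  set A : ENNReal := ENNReal.ofReal (C₁ * C₂) with hA
  refine ⟨A ^ 2 * (∑' k : Lattice n, decayWeight k) ^ 2, ENNReal.mul_ne_top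
    (ENNReal.pow_ne_top ENNReal.ofReal_ne_top) (ENNReal.pow_ne_top (tsum_decayWeight_ne_top n)),
    fun f => ?_⟩
  have hpt : ∀ k, ‖latticeOp σ f k‖ₑ ≤
      A * ∑' i, decayWeight i * weightedNorm Λ m f (k - i) := fun k => by
    refine (enorm_tsum_le _).trans ?_
    rw [← ENNReal.tsum_mul_left]
    refine ENNReal.tsum_le_tsum fun i => ?_
    have hi := bracket_pos i
    have hki := hΛ.pos (k - i)
    rw [← ofReal_norm, hA, decayWeight, weightedNorm, ← ENNReal.ofReal_mul (by positivity),
      ← ENNReal.ofReal_mul (by positivity), norm_mul]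
    apply ENNReal.ofReal_le_ofReal
    have h1 := hQ (k - i) i
    rw [sub_add_cancel] at h1
    calc _ ≤ C₂ * (bracket i ^ (Q + 2 * n))⁻¹ * (C₁ * bracket i ^ Q * Λ (k - i) ^ m) *
          ‖f (k - i)‖ := by
          gcongr
          exact (h k i).trans (by gcongr)
      _ = _ := by
          rw [pow_add]
          field_simp
  calc _ ≤ _ := sqSum_mono hpt
    _ = A ^ 2 * _ := sqSum_const_mul _ _
    _ ≤ A ^ 2 * ((∑' k : Lattice n, decayWeight k) ^ 2 * sqSum (weightedNorm Λ m f)) := by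
        gcongr; exact sqSum_conv_le _ _
    _ = _ := by rw [mul_assoc]

/-- The coefficients of 1/σ(k, ·) cancel the factor Λ(k)^m, and the variation of the symbol leaves
Λ^{m-ρ}: the error has order lower by ρ. -/
lemma exists_parametrix_error_le (hΛ : IsWeight μ Λ) (hσ : σ ∈ symbolS m ρ Λ) {c R : ℝ}
    (hc : 0 < c) (hell : ∀ k x, R ≤ euclNorm k → c * Λ k ^ m ≤ ‖σ k x‖) :
    ∃ C, 0 < C ∧ ∀ k, R ≤ euclNorm k → ∀ j i,
      Λ k ^ m * ‖fourierLatticeInv (fun x => (σ k x)⁻¹) j‖ *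
        ‖fourierLatticeInv (σ (k - j)) i - fourierLatticeInv (σ k) i‖ ≤
      C * (bracket j ^ (2 * n))⁻¹ * (bracket i ^ (2 * n))⁻¹ * Λ (k - j - i) ^ (m - ρ) := by
  obtain ⟨C₁, hC₁, Q, hQ⟩ := hΛ.exists_rpow_add_le (m - ρ)
  obtain ⟨Q', hQ'⟩ := exists_coeff_sub_le hΛ hσ
  obtain ⟨C₂, hC₂, h₂⟩ := hQ' (Q + 2 * n)
  -- In `j`, the decay must absorb `Q` from Peetre's inequality and `Q'` from the difference of
  -- coefficients, with 2n left for summation.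
  obtain ⟨C₃, hC₃, h₃⟩ := exists_inv_coeff_le hΛ hσ hc hell (Q + Q' + 2 * n)
  refine ⟨C₁ * C₂ * C₃, by positivity, fun k hk j i => ?_⟩
  have hi := bracket_pos i
  have hj := bracket_pos j
  have hL := hΛ.pos (k - j - i)
  have h1 := hQ (k - j - i) (j + i)
  rw [show k - j - i + (j + i) = k by abel] at h1
  have h4 : Λ k ^ (m - ρ) ≤ C₁ * (bracket j * bracket i) ^ Q * Λ (k - j - i) ^ (m - ρ) := by
    refine h1.trans ?_
    have := bracket_pos (j + i)
    gcongr
    exact bracket_add_le j i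
  calc _ ≤ (C₃ * (bracket j ^ (Q + Q' + 2 * n))⁻¹) *
        (C₂ * bracket j ^ Q' * (bracket i ^ (Q + 2 * n))⁻¹ *
          (C₁ * (bracket j * bracket i) ^ Q * Λ (k - j - i) ^ (m - ρ))) :=
        mul_le_mul (h₃ k hk j) ((h₂ k j i).trans (by gcongr)) (norm_nonneg _) (by positivity)
    _ = _ := by
        rw [pow_add, pow_add, pow_add, mul_pow]
        field_simp

end Kernel

/-! ### The elliptic estimate -/

section Elliptic

variable {n : ℕ} {μ m ρ : ℝ} {Λ : Lattice n → ℝ} {σ : Symbol n}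

lemma weightedNorm_eq_mul {s : ℝ} (hΛ : IsWeight μ Λ) (f : Lattice n → ℂ) (k : Lattice n) :
    weightedNorm Λ s f k = ENNReal.ofReal (Λ k ^ s) * ‖f k‖ₑ := by
  have := hΛ.pos k
  rw [weightedNorm, ENNReal.ofReal_mul (by positivity), ofReal_norm]

lemma exists_weightedNorm_le_parametrix (hΛ : IsWeight μ Λ) (hσ : σ ∈ symbolS m ρ Λ) {c R : ℝ}
    (hc : 0 < c) (hell : ∀ k x, R ≤ euclNorm k → c * Λ k ^ m ≤ ‖σ k x‖) :
    ∃ A : ENNReal, A ≠ ⊤ ∧ ∀ f : Lattice n → ℂ, (Summable fun k => ‖f k‖) →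
      ∀ k, R ≤ euclNorm k → weightedNorm Λ m f k ≤
        A * ((∑' j, decayWeight j * ‖latticeOp σ f (k - j)‖ₑ) +
          ∑' j, decayWeight j * ∑' i, decayWeight i * weightedNorm Λ (m - ρ) f (k - j - i)) := by
  obtain ⟨C₁, hC₁, h₁⟩ := exists_inv_coeff_le hΛ hσ hc hell (2 * n)
  obtain ⟨C₂, hC₂, h₂⟩ := exists_parametrix_error_le hΛ hσ hc hell
  refine ⟨ENNReal.ofReal (C₁ + C₂), ENNReal.ofReal_ne_top, fun f hf k hk => ?_⟩
  have hL := hΛ.pos k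
  have hLm := Real.rpow_pos_of_pos hL m
  set a : Lattice n → Lattice n → ℂ := fun k => fourierLatticeInv (σ k) with ha
  set b : Lattice n → ℂ := fourierLatticeInv (fun x => (σ k x)⁻¹) with hb
  have hbs : Summable fun j => ‖b j‖ := by
    refine summable_of_bracket_bound (C := (Λ k ^ m)⁻¹ * C₁) fun j => ?_
    rw [mul_assoc, ← div_eq_inv_mul, le_div_iff₀ hLm, mul_comm]
    exact h₁ k hk j
  have hne : ∀ x, σ k x ≠ 0 := fun x h0 => by
    have := hell k x hk
    rw [h0, norm_zero] at this
    have : 0 < c * Λ k ^ m := by positivity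
    linarith
  have hbd : ∀ i, ‖f i‖ ≤ ∑' k, ‖f k‖ := fun i => hf.le_tsum i fun _ _ => norm_nonneg _
  have hrep := eq_tsum_fourierLatticeInv_inv (symbolS_continuous hσ k) hne hbs hf k
  -- Unfreezing: exchanging a_k for a_{k-j} makes the inner sum equal to T_σ f at k - j, up to the
  -- error term.
  have hsplit : ∀ j, ∑' i, a k i * f (k - j - i) =
      latticeOp σ f (k - j) - ∑' i, (a (k - j) i - a k i) * f (k - j - i) := fun j => by
    have s1 := summable_mul_of_bounded (summable_coeff hΛ hσ (k - j)) hbd fun i => k - j - i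
    have s2 := summable_mul_of_bounded (summable_coeff hΛ hσ k) hbd fun i => k - j - i
    simp only [sub_mul]
    rw [s1.tsum_sub s2, latticeOp, sub_sub_cancel]
  rw [weightedNorm_eq_mul hΛ, hrep]
  calc _ ≤ ENNReal.ofReal (Λ k ^ m) * ∑' j, ‖b j‖ₑ *
        (‖latticeOp σ f (k - j)‖ₑ + ∑' i, ‖a (k - j) i - a k i‖ₑ * ‖f (k - j - i)‖ₑ) := by
        gcongr
        refine (enorm_tsum_le _).trans (ENNReal.tsum_le_tsum fun j => ?_)
        rw [enorm_mul]
        gcongr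
        refine (congrArg _ (hsplit j)).trans_le (enorm_sub_le.trans ?_)
        gcongr
        refine (enorm_tsum_le _).trans (le_of_eq ?_)
        simp only [enorm_mul]
    _ = (∑' j, ENNReal.ofReal (Λ k ^ m) * ‖b j‖ₑ * ‖latticeOp σ f (k - j)‖ₑ) +
        ∑' j, ∑' i, ENNReal.ofReal (Λ k ^ m) * ‖b j‖ₑ * ‖a (k - j) i - a k i‖ₑ *
          ‖f (k - j - i)‖ₑ := by
        rw [← ENNReal.tsum_add, ← ENNReal.tsum_mul_left]
        refine tsum_congr fun j => ?_
        rw [← mul_assoc, mul_add, ← ENNReal.tsum_mul_left]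
        simp only [mul_assoc]
    _ ≤ (∑' j, ENNReal.ofReal (C₁ + C₂) * (decayWeight j * ‖latticeOp σ f (k - j)‖ₑ)) +
        ∑' j, ∑' i, ENNReal.ofReal (C₁ + C₂) *
          (decayWeight j * (decayWeight i * weightedNorm Λ (m - ρ) f (k - j - i))) := by
        refine add_le_add (ENNReal.tsum_le_tsum fun j => ?_)
          (ENNReal.tsum_le_tsum fun j => ENNReal.tsum_le_tsum fun i => ?_)
        · rw [← mul_assoc, decayWeight]
          have := bracket_pos j
          refine mul_le_mul_left ?_ _
          rw [← ofReal_norm, ← ENNReal.ofReal_mul hLm.le, ← ENNReal.ofReal_mul (by positivity)]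
          refine ENNReal.ofReal_le_ofReal ((h₁ k hk j).trans ?_)
          gcongr
          linarith
        · have hj := bracket_pos j
          have hi := bracket_pos i
          have hL' := hΛ.pos (k - j - i)
          rw [weightedNorm, decayWeight, decayWeight, ← ofReal_norm, ← ofReal_norm, ← ofReal_norm,
            ← ENNReal.ofReal_mul (by positivity), ← ENNReal.ofReal_mul (by positivity),
            ← ENNReal.ofReal_mul (by positivity), ← ENNReal.ofReal_mul (by positivity),
            ← ENNReal.ofReal_mul (by positivity), ← ENNReal.ofReal_mul (by positivity)]
          apply ENNReal.ofReal_le_ofReal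
          calc _ ≤ C₂ * (bracket j ^ (2 * n))⁻¹ * (bracket i ^ (2 * n))⁻¹ *
                Λ (k - j - i) ^ (m - ρ) * ‖f (k - j - i)‖ :=
                mul_le_mul_of_nonneg_right (h₂ k hk j i) (norm_nonneg _)
            _ ≤ (C₁ + C₂) * (bracket j ^ (2 * n))⁻¹ * (bracket i ^ (2 * n))⁻¹ *
                Λ (k - j - i) ^ (m - ρ) * ‖f (k - j - i)‖ := by
                gcongr; linarith
            _ = _ := by ring
    _ = _ := by
        simp only [ENNReal.tsum_mul_left]
        rw [mul_add]

/-- Split at Λ = M. Above, Λ^{-2ρ} ≤ M^{-2ρ} = ε; below, Λ lies in a compact interval [c, M], on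
which Λ^{m-ρ} is bounded. -/
lemma exists_sqSum_lower_order_le (hΛ : IsWeight μ Λ) (hρ : 0 < ρ) {ε : ℝ} (hε : 0 < ε) :
    ∃ B : ENNReal, B ≠ ⊤ ∧ ∀ f : Lattice n → ℂ, sqSum (weightedNorm Λ (m - ρ) f) ≤
      ENNReal.ofReal ε * sqSum (weightedNorm Λ m f) + B * sqSum fun k => ‖f k‖ₑ := by
  obtain ⟨c, hc, hck⟩ := hΛ.exists_le
  set M : ℝ := ε ^ (-(2 * ρ))⁻¹ with hM
  have hM0 : 0 < M := by positivity
  obtain ⟨B, hB, hB'⟩ := exists_rpow_le_of_mem_Icc hc M (m - ρ)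
  refine ⟨ENNReal.ofReal (B ^ 2), ENNReal.ofReal_ne_top, fun f => ?_⟩
  unfold sqSum
  rw [← ENNReal.tsum_mul_left, ← ENNReal.tsum_mul_left, ← ENNReal.tsum_add]
  refine ENNReal.tsum_le_tsum fun k => ?_
  have hL := hΛ.pos k
  rw [weightedNorm_eq_mul hΛ, weightedNorm_eq_mul hΛ, mul_pow, mul_pow, ← mul_assoc, ← add_mul]
  gcongr
  rcases le_total (Λ k) M with h | h
  · refine le_add_left ?_
    rw [← ENNReal.ofReal_pow (by positivity)]
    apply ENNReal.ofReal_le_ofReal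
    gcongr
    exact hB' _ (hck k) h
  · refine le_add_right ?_
    rw [← ENNReal.ofReal_pow (by positivity), ← ENNReal.ofReal_pow (by positivity),
      ← ENNReal.ofReal_mul hε.le]
    apply ENNReal.ofReal_le_ofReal
    have h1 : Λ k ^ (-(2 * ρ)) ≤ ε := by
      refine (Real.rpow_le_rpow_of_nonpos hM0 h (by linarith)).trans (le_of_eq ?_)
      exact Real.rpow_inv_rpow hε.le (by linarith)
    have h2 : (Λ k ^ (m - ρ)) ^ 2 = Λ k ^ (-(2 * ρ)) * (Λ k ^ m) ^ 2 := by
      rw [← Real.rpow_natCast, ← Real.rpow_natCast, ← Real.rpow_mul hL.le, ← Real.rpow_mul hL.le,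
        ← Real.rpow_add hL]
      congr 1
      push_cast
      ring
    rw [h2]
    gcongr

lemma IsWeight.exists_rpow_le_of_euclNorm_le (hΛ : IsWeight μ Λ) (s R : ℝ) :
    ∃ B, 0 < B ∧ ∀ k, euclNorm k ≤ R → Λ k ^ s ≤ B := by
  obtain ⟨c, hc, hck⟩ := hΛ.exists_le
  obtain ⟨⟨μ₀, μ₁, C₀, C₁, h0, h1, h2, hC, hC₁, hk⟩, _⟩ := hΛ
  obtain ⟨B, hB, h⟩ := exists_rpow_le_of_mem_Icc hc (C₁ * (1 + R) ^ μ₁) s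
  refine ⟨B, hB, fun k hkR => h _ (hck k) ((hk k).2.trans ?_)⟩
  have := one_le_one_add_euclNorm k
  gcongr
  linarith

lemma sqSum_weightedNorm_ne_top (hΛ : IsWeight μ Λ) {f : Lattice n → ℂ} (hf : IsSchwartz f) :
    sqSum (weightedNorm Λ m f) ≠ ⊤ := by
  obtain ⟨C₁, hC₁, Q, hQ⟩ := hΛ.exists_rpow_le m
  obtain ⟨C₂, hC₂⟩ := hf.exists_bracket_bound (Q + 2 * n)
  have h1 : ∀ k, weightedNorm Λ m f k ≤ ENNReal.ofReal (C₁ * C₂) * decayWeight k := fun k => by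
    have hb := bracket_pos k
    have hL := hΛ.pos k
    rw [weightedNorm, decayWeight, ← ENNReal.ofReal_mul' (by positivity)]
    apply ENNReal.ofReal_le_ofReal
    calc _ ≤ (C₁ * bracket k ^ Q) * (C₂ * (bracket k ^ (Q + 2 * n))⁻¹) := by
          gcongr
          · exact hQ k
          · exact hC₂ k
      _ = _ := by
          rw [pow_add]
          field_simp
  have h2 : ∀ k : Lattice n, (decayWeight k : ENNReal) ^ 2 ≤ decayWeight k := fun k => by
    have : decayWeight k ≤ 1 := by
      rw [decayWeight, ENNReal.ofReal_le_one]
      exact inv_le_one_of_one_le₀ (one_le_pow₀ (one_le_bracket k))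
    calc _ = decayWeight k * decayWeight k := sq _
      _ ≤ decayWeight k * 1 := by gcongr
      _ = _ := mul_one _
  refine ne_top_of_le_ne_top ?_ ((sqSum_mono h1).trans_eq (sqSum_const_mul _ _))
  refine ENNReal.mul_ne_top (ENNReal.pow_ne_top ENNReal.ofReal_ne_top) ?_
  exact ne_top_of_le_ne_top (tsum_decayWeight_ne_top n) (ENNReal.tsum_le_tsum h2)

/-- The absorption step. Finiteness of `x` is essential, which is why the elliptic estimate is
proved on Schwartz functions first. -/
lemma ENNReal_le_two_mul_of_le_add_half {x a : ENNReal} (hx : x ≠ ⊤) (h : x ≤ a + x / 2) :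
    x ≤ 2 * a := by
  nth_rewrite 1 [← ENNReal.add_halves x] at h
  rw [ENNReal.add_le_add_iff_right (ENNReal.div_ne_top hx two_ne_zero)] at h
  calc x = 2 * (x / 2) := by rw [ENNReal.mul_div_cancel two_ne_zero ENNReal.ofNat_ne_top]
    _ ≤ _ := by gcongr

/-- The elliptic estimate. -/
lemma exists_elliptic_estimate (hΛ : IsWeight μ Λ) (hρ : 0 < ρ) (hσ : σ ∈ symbolS m ρ Λ)
    (hell : IsMElliptic m Λ σ) :
    ∃ C : ENNReal, C ≠ ⊤ ∧ ∀ f : Lattice n → ℂ, IsSchwartz f →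
      sqSum (weightedNorm Λ m f) ≤
        C * (sqSum (fun k => ‖latticeOp σ f k‖ₑ) + sqSum fun k => ‖f k‖ₑ) := by
  obtain ⟨c, R, hc, _, hell⟩ := hell
  obtain ⟨A, hA, h₁⟩ := exists_weightedNorm_le_parametrix hΛ hσ hc fun k x => hell k x
  obtain ⟨B, hB, h₂⟩ := hΛ.exists_rpow_le_of_euclNorm_le m R
  set W : ENNReal := ∑' k : Lattice n, decayWeight k with hW
  have hWt : W ≠ ⊤ := tsum_decayWeight_ne_top n
  set K₁ : ENNReal := 2 * (A ^ 2 * (2 * W ^ 2)) with hK₁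
  set K₂ : ENNReal := 2 * (A ^ 2 * (2 * (W ^ 2 * W ^ 2))) with hK₂
  have hK₁t : K₁ ≠ ⊤ := by finiteness
  have hK₂t : K₂ ≠ ⊤ := by finiteness
  -- This ε makes K₂ ε at most 1/2, where `K₂` is the coefficient of the lower-order term in
  -- `hmain`.
  obtain ⟨D, hD, h₃⟩ := exists_sqSum_lower_order_le (m := m) hΛ hρ
    (ε := (2 * (K₂.toReal + 1))⁻¹) (by positivity)
  have hε : K₂ * ENNReal.ofReal (2 * (K₂.toReal + 1))⁻¹ ≤ 2⁻¹ := by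
    rw [← ENNReal.ofReal_toReal hK₂t, ← ENNReal.ofReal_mul ENNReal.toReal_nonneg,
      ENNReal.toReal_ofReal ENNReal.toReal_nonneg, show (2 : ENNReal)⁻¹ = ENNReal.ofReal 2⁻¹ by
        rw [ENNReal.ofReal_inv_of_pos two_pos, ENNReal.ofReal_ofNat]]
    apply ENNReal.ofReal_le_ofReal
    have : 0 ≤ K₂.toReal := ENNReal.toReal_nonneg
    rw [mul_inv, mul_left_comm]
    refine mul_le_of_le_one_right (by positivity) ?_
    rw [← div_eq_mul_inv, div_le_one (by positivity)]
    linarith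
  set E : ENNReal := K₁ + (K₂ * D + 2 * ENNReal.ofReal B ^ 2) with hE
  refine ⟨2 * E, by finiteness, fun f hf => ?_⟩
  have hfs := hf.summable_norm
  -- The last term covers |k| ≤ R, where there is no ellipticity but Λ^m is bounded.
  have hpt : ∀ k, weightedNorm Λ m f k ≤
      A * ((∑' j, decayWeight j * ‖latticeOp σ f (k - j)‖ₑ) +
        ∑' j, decayWeight j * ∑' i, decayWeight i * weightedNorm Λ (m - ρ) f (k - j - i)) +
      ENNReal.ofReal B * ‖f k‖ₑ := fun k => by
    rcases le_total R (euclNorm k) with h | h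
    · exact le_add_right (h₁ f hfs k h)
    · refine le_add_left ?_
      rw [weightedNorm_eq_mul hΛ]
      gcongr
      exact h₂ k h
  set X := sqSum (weightedNorm Λ m f) with hX
  set T := sqSum fun k => ‖latticeOp σ f k‖ₑ with hT
  set F := sqSum fun k => ‖f k‖ₑ with hF
  have hmain : X ≤ K₁ * T + K₂ * sqSum (weightedNorm Λ (m - ρ) f) +
      2 * ENNReal.ofReal B ^ 2 * F := by
    refine (sqSum_mono hpt).trans ((sqSum_add_le _ _).trans ?_)
    rw [sqSum_const_mul, sqSum_const_mul, ← mul_assoc 2 (ENNReal.ofReal B ^ 2)]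
    gcongr
    calc _ ≤ 2 * (A ^ 2 * (2 * (W ^ 2 * T) +
          2 * (W ^ 2 * (W ^ 2 * sqSum (weightedNorm Λ (m - ρ) f))))) := by
          gcongr
          refine (sqSum_add_le _ _).trans ?_
          gcongr
          · exact sqSum_conv_le _ _
          · refine (sqSum_conv_le decayWeight fun k =>
              ∑' i, decayWeight i * weightedNorm Λ (m - ρ) f (k - i)).trans ?_
            gcongr
            exact sqSum_conv_le _ _
      _ = _ := by rw [hK₁, hK₂]; ring
  have habs : X ≤ E * (T + F) + X / 2 := by
    calc X ≤ K₁ * T + K₂ * (ENNReal.ofReal (2 * (K₂.toReal + 1))⁻¹ * X + D * F) +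
          2 * ENNReal.ofReal B ^ 2 * F := by
          refine hmain.trans ?_
          gcongr
          exact h₃ f
      _ = K₁ * T + (K₂ * D + 2 * ENNReal.ofReal B ^ 2) * F +
          K₂ * ENNReal.ofReal (2 * (K₂.toReal + 1))⁻¹ * X := by ring
      _ ≤ E * T + E * F + 2⁻¹ * X := by
          gcongr
          · exact le_self_add
          · exact le_add_self
      _ = _ := by rw [mul_add, div_eq_mul_inv, mul_comm X]
  have := ENNReal_le_two_mul_of_le_add_half (sqSum_weightedNorm_ne_top hΛ hf) habs
  rwa [mul_assoc]

end Elliptic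

/-! ### The domain of the minimal operator -/

section Domain

variable {n : ℕ} {μ m ρ : ℝ} {Λ : Lattice n → ℝ} {σ : Symbol n}

lemma memℓp_weightPowD_iff (hΛ : IsWeight μ Λ) {w : Lattice n → ℂ} :
    Memℓp (weightPowD Λ m w) 2 ↔ sqSum (weightedNorm Λ m w) ≠ ⊤ := by
  rw [memℓp_two_iff]
  have : (fun k => ‖weightPowD Λ m w k‖ₑ) = weightedNorm Λ m w := by
    ext k
    have := hΛ.pos k
    rw [weightPowD_apply, ← ofReal_norm, norm_mul, Complex.norm_real,
      Real.norm_of_nonneg (by positivity), weightedNorm]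
  rw [this]

lemma isTempered_ellTwo (u : ellTwo n) : IsTempered (u : Lattice n → ℂ) :=
  ⟨0, ‖u‖, fun k => by simpa using lp.norm_apply_le_norm two_ne_zero u k⟩

/-- Fatou's lemma: `ℓ²` convergence implies pointwise convergence, so each finite partial sum of the
limit is at most `B`. -/
lemma sqSum_le_of_tendsto {φ : ℕ → ellTwo n} {g : ellTwo n}
    (hφ : Tendsto φ atTop (𝓝 g)) {B : ENNReal}
    (hB : ∀ j, sqSum (weightedNorm Λ m (φ j)) ≤ B) : sqSum (weightedNorm Λ m g) ≤ B := by
  have hpt : ∀ k, Tendsto (fun j => (φ j : Lattice n → ℂ) k) atTop (𝓝 ((g : Lattice n → ℂ) k)) :=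
    fun k => by
      rw [tendsto_iff_norm_sub_tendsto_zero] at hφ ⊢
      refine squeeze_zero (fun _ => norm_nonneg _) (fun j => ?_) hφ
      simpa using lp.norm_apply_le_norm two_ne_zero (φ j - g) k
  unfold sqSum
  rw [ENNReal.tsum_eq_iSup_sum]
  refine iSup_le fun s => ?_
  have hlim : Tendsto (fun j => ∑ k ∈ s, weightedNorm Λ m (φ j) k ^ 2) atTop
      (𝓝 (∑ k ∈ s, weightedNorm Λ m g k ^ 2)) := by
    refine tendsto_finsetSum _ fun k _ => ?_
    refine ENNReal.Tendsto.pow ?_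
    exact ENNReal.tendsto_ofReal ((hpt k).norm.const_mul _)
  exact le_of_tendsto' hlim fun j => (ENNReal.sum_le_tsum s).trans (hB j)

lemma exists_sqSum_enorm_le_of_tendsto {φ : ℕ → ellTwo n} {g : ellTwo n}
    (hφ : Tendsto φ atTop (𝓝 g)) :
    ∃ B : ENNReal, B ≠ ⊤ ∧ ∀ j, sqSum (fun k => ‖φ j k‖ₑ) ≤ B := by
  obtain ⟨B, hB⟩ := hφ.norm.bddAbove_range
  refine ⟨ENNReal.ofReal (B ^ 2), ENNReal.ofReal_ne_top, fun j => ?_⟩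
  rw [sqSum_enorm_ellTwo]
  have := hB (Set.mem_range_self j)
  gcongr

lemma tendsto_ellTwo_of_sqSum {φ : ℕ → ellTwo n} {g : ellTwo n}
    (h : Tendsto (fun j => sqSum fun k => ‖φ j k - g k‖ₑ) atTop (𝓝 0)) :
    Tendsto φ atTop (𝓝 g) := by
  rw [tendsto_iff_norm_sub_tendsto_zero]
  have h1 : ∀ j, sqSum (fun k => ‖φ j k - g k‖ₑ) = ENNReal.ofReal (‖φ j - g‖ ^ 2) := fun j => by
    rw [← sqSum_enorm_ellTwo]; rfl
  simp only [h1] at h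
  have h2 := (ENNReal.tendsto_toReal ENNReal.zero_ne_top).comp h
  simp only [Function.comp_def, ENNReal.toReal_ofReal (sq_nonneg _), ENNReal.toReal_zero] at h2
  simpa using h2.sqrt

lemma mem_weightedSobolev_of_mem_minimalDomain (hΛ : IsWeight μ Λ) (hρ : 0 < ρ)
    (hσ : σ ∈ symbolS m ρ Λ) (hell : IsMElliptic m Λ σ) {g : ellTwo n}
    (hg : g ∈ minimalDomain σ) : (g : Lattice n → ℂ) ∈ weightedSobolev m Λ := by
  obtain ⟨f, φ, ψ, hφS, hψ, hφ, hψf⟩ := hg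
  obtain ⟨C, hC, hest⟩ := exists_elliptic_estimate hΛ hρ hσ hell
  obtain ⟨B₁, hB₁, h₁⟩ := exists_sqSum_enorm_le_of_tendsto hφ
  obtain ⟨B₂, hB₂, h₂⟩ := exists_sqSum_enorm_le_of_tendsto hψf
  refine ⟨isTempered_ellTwo g, (memℓp_weightPowD_iff hΛ).mpr ?_⟩
  refine ne_top_of_le_ne_top (b := C * (B₂ + B₁)) (by finiteness) ?_
  refine sqSum_le_of_tendsto hφ fun j => (hest _ (hφS j)).trans ?_
  have h3 : latticeOp σ (φ j) = ψ j := by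
    rw [hψ, pseudoDiff_eq_latticeOp (symbolS_continuous hσ) (hφS j).summable_norm]
  have h4 := h₁ j
  have h5 := h₂ j
  rw [h3]
  gcongr

lemma isSchwartz_of_finite_support {f : Lattice n → ℂ} (s : Finset (Lattice n))
    (hf : ∀ k, k ∉ s → f k = 0) : IsSchwartz f := by
  intro N
  have hnn : ∀ k : Lattice n, 0 ≤ (1 + euclNorm k) ^ N * ‖f k‖ := fun k => by
    have := one_le_one_add_euclNorm k
    positivity
  refine ⟨∑ k ∈ s, (1 + euclNorm k) ^ N * ‖f k‖, fun k => ?_⟩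
  by_cases hk : k ∈ s
  · exact Finset.single_le_sum (f := fun k => (1 + euclNorm k) ^ N * ‖f k‖) (fun k _ => hnn k) hk
  · rw [hf k hk, norm_zero, mul_zero]
    exact Finset.sum_nonneg fun k _ => hnn k

lemma latticeOp_sub (hΛ : IsWeight μ Λ) (hσ : σ ∈ symbolS m ρ Λ) (u v : ellTwo n) (k : Lattice n) :
    latticeOp σ u k - latticeOp σ v k = latticeOp σ (fun k => u k - v k) k := by
  have s := fun u : ellTwo n => summable_mul_of_bounded (summable_coeff hΛ hσ k)
    (fun i => lp.norm_apply_le_norm two_ne_zero u i) fun i => k - i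
  unfold latticeOp
  rw [← (s u).tsum_sub (s v)]
  simp only [mul_sub]

lemma mem_minimalDomain_of_mem_weightedSobolev (hΛ : IsWeight μ Λ) (hσ : σ ∈ symbolS m ρ Λ)
    {u : ellTwo n} (hu : (u : Lattice n → ℂ) ∈ weightedSobolev m Λ) : u ∈ minimalDomain σ := by
  classical
  obtain ⟨C, hC, hbd⟩ := exists_sqSum_latticeOp_le hΛ hσ
  have hum := (memℓp_weightPowD_iff hΛ).mp hu.2
  have hu0 := memℓp_two_iff.mp (lp.memℓp u)
  have hmem : ∀ f : Lattice n → ℂ, sqSum (weightedNorm Λ m f) ≠ ⊤ → Memℓp (latticeOp σ f) 2 :=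
    fun f hf => memℓp_two_iff.mpr (ne_top_of_le_ne_top (ENNReal.mul_ne_top hC hf) (hbd f))
  -- A sequence of finite sets exhausting the lattice; the approximants `c j` are the restrictions
  -- of `u` to them.
  obtain ⟨s, hs⟩ := exists_seq_tendsto (atTop : Filter (Finset (Lattice n)))
  set c : ℕ → Lattice n → ℂ := fun j k => if k ∈ s j then u k else 0 with hc
  have hcS : ∀ j, IsSchwartz (c j) := fun j =>
    isSchwartz_of_finite_support (s j) fun k hk => by simp [hc, hk]
  have hcm : ∀ j, Memℓp (c j) 2 := fun j => by
    refine memℓp_two_iff.mpr (ne_top_of_le_ne_top hu0 (sqSum_mono fun k => ?_))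
    by_cases hk : k ∈ s j <;> simp [hc, hk]
  have htail : ∀ g : Lattice n → ENNReal, sqSum g ≠ ⊤ → ∀ g' : ℕ → Lattice n → ENNReal,
      (∀ j k, g' j k = if k ∈ s j then 0 else g k) →
      Tendsto (fun j => sqSum (g' j)) atTop (𝓝 0) := fun g hg g' hg' => by
    refine ((ENNReal.tendsto_tsum_compl_atTop_zero hg).comp hs).congr fun j => ?_
    simp only [Function.comp_def]
    rw [sqSum, ← tsum_subtype_eq_of_support_subset (s := {k | k ∉ s j})]
    · refine tsum_congr fun k => ?_
      rw [hg', if_neg k.2]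
    · intro k hk hks
      rw [Function.mem_support, hg', if_pos hks] at hk
      simp at hk
  have h1 : Tendsto (fun j => sqSum fun k => ‖c j k - u k‖ₑ) atTop (𝓝 0) := by
    refine htail _ hu0 _ fun j k => ?_
    by_cases hk : k ∈ s j <;> simp [hc, hk]
  have h2 : Tendsto (fun j => sqSum (weightedNorm Λ m fun k => c j k - u k)) atTop (𝓝 0) := by
    refine htail _ hum _ fun j k => ?_
    by_cases hk : k ∈ s j <;> simp [hc, hk, weightedNorm]
  have hcw : ∀ j, Memℓp (latticeOp σ (c j)) 2 := fun j =>
    hmem _ (sqSum_weightedNorm_ne_top hΛ (hcS j))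
  refine ⟨⟨latticeOp σ u, hmem _ hum⟩, fun j => ⟨c j, hcm j⟩, fun j => ⟨latticeOp σ (c j), hcw j⟩,
    hcS, fun j => ?_, tendsto_ellTwo_of_sqSum h1, tendsto_ellTwo_of_sqSum ?_⟩
  · exact (pseudoDiff_eq_latticeOp (symbolS_continuous hσ) (hcS j).summable_norm).symm
  -- By linearity and boundedness from the weighted space to `ℓ²`, T_σ(c_j) - T_σ u is controlled by
  -- the weighted norm of c_j - u.
  · have h3 := ENNReal.Tendsto.const_mul h2 (Or.inr hC)
    rw [mul_zero] at h3
    refine tendsto_of_tendsto_of_tendsto_of_le_of_le tendsto_const_nhds h3 (fun _ => zero_le)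
      fun j => ?_
    refine le_trans (le_of_eq ?_) (hbd fun k => c j k - u k)
    congr 1
    ext k
    exact congrArg _ (latticeOp_sub hΛ hσ ⟨c j, hcm j⟩ u k)

/-- Λ is bounded below by c > 0, so Λ^m ≥ c^m when m ≥ 0. -/
lemma memℓp_of_mem_weightedSobolev (hΛ : IsWeight μ Λ) (hm : 0 ≤ m) {w : Lattice n → ℂ}
    (hw : w ∈ weightedSobolev m Λ) : Memℓp w 2 := by
  obtain ⟨c, hc, hck⟩ := hΛ.exists_le
  have h := (memℓp_weightPowD_iff hΛ).mp hw.2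
  refine memℓp_two_iff.mpr (ne_top_of_le_ne_top
    (ENNReal.mul_ne_top (ENNReal.pow_ne_top (ENNReal.ofReal_ne_top (r := (c ^ m)⁻¹))) h)
    ((sqSum_mono fun k => ?_).trans_eq (sqSum_const_mul _ _)))
  have hcm : 0 < c ^ m := by positivity
  rw [weightedNorm, ← ofReal_norm, ← ENNReal.ofReal_mul (by positivity)]
  apply ENNReal.ofReal_le_ofReal
  rw [← div_eq_inv_mul, le_div_iff₀ hcm, mul_comm]
  gcongr
  exact hck k

end Domain

end LatticePDO

end

theorem mainTheorem5 (n : ℕ) (μ m ρ : ℝ) (Λ : LatticePDO.Lattice n → ℝ)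
    (hΛ : LatticePDO.IsWeight μ Λ) (hρ₀ : 0 < ρ) (hρ : ρ ≤ 1 / μ)
    (σ : LatticePDO.Symbol n) (hσ : σ ∈ LatticePDO.symbolM m ρ Λ)
    (hell : LatticePDO.IsMElliptic m Λ σ) :
    LatticePDO.minimalDomain σ =
        {u : LatticePDO.ellTwo n |
          (u : LatticePDO.Lattice n → ℂ) ∈ LatticePDO.weightedSobolev m Λ} ∧
      (0 ≤ m →
        (fun u : LatticePDO.ellTwo n => (u : LatticePDO.Lattice n → ℂ)) ''
            LatticePDO.minimalDomain σ =
          LatticePDO.weightedSobolev m Λ) := by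
  have hσS := LatticePDO.symbolM_subset_symbolS hσ
  have hdom : LatticePDO.minimalDomain σ = {u : LatticePDO.ellTwo n |
      (u : LatticePDO.Lattice n → ℂ) ∈ LatticePDO.weightedSobolev m Λ} :=
    Set.Subset.antisymm
      (fun _ => LatticePDO.mem_weightedSobolev_of_mem_minimalDomain hΛ hρ₀ hσS hell)
      (fun _ => LatticePDO.mem_minimalDomain_of_mem_weightedSobolev hΛ hσS)
  refine ⟨hdom, fun hm => ?_⟩
  rw [hdom]
  refine Set.Subset.antisymm ?_ fun w hw => ?_
  · rintro _ ⟨u, hu, rfl⟩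
    exact hu
  · exact ⟨⟨w, LatticePDO.memℓp_of_mem_weightedSobolev hΛ hm hw⟩, hw, rfl⟩
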